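/- **Definitions.** A *difference–restriction algebra* is a nonempty algebra $(A,-,\rhd)$ isomorphic to an algebra of partial functions from a set $X$ to a set $Y$, where $f-g$ is set difference and $f\rhd g$ is the restriction of $g$ to the domain of $f$. Put $a\cdot b:=a-(a-b)$, let $a\le b$ mean $a\cdot b=a$, write $0:=a-a$, and call $a,b$ *compatible* if $a\rhd b=b\rhd a$. $\mathrm{DRA}$ is the category of these algebras and their homomorphisms. A *filter* is a nonempty, upward closed subset closed under $\cdot$; a *maximal filter* is maximal among the proper filters; for maximal filters, $\mu\approx\nu$ means that $a\rhd b\in\nu$ for all $a\in\mu$, $b\in\nu$. A *Hausdorff étale space* is a surjective local homeomorphism $\pi\colon X\to X_0$ with $X$ and $X_0$ Hausdorff. $\mathrm{HausEt}$ is the category of these, a morphism from $\pi\colon X\to X_0$ to $\rho\colon Y\to Y_0$ being a partial function $\varphi\colon X\rightharpoonup Y$ such that preimages of open sets are open, preimages of compact sets are compact, and: (1) if $\varphi(x),\varphi(x')$ are defined and $\pi(x)=\pi(x')$, then $\rho(\varphi(x))=\rho(\varphi(x'))$; (2) if moreover $\varphi(x)=\varphi(x')$, then $x=x'$; (3) if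 $\varphi(x)$ is defined and $\rho(y)=\rho(\varphi(x))$, then there is $x'$ with $\pi(x')=\pi(x)$ and $\varphi(x')=y$. The functor $F\colon\mathrm{DRA}\to\mathrm{HausEt}^{\mathrm{op}}$ sends $A$ to the quotient map from the space of maximal filters of $A$, with the topology generated by the sets $\widehat a=\{\mu\mid a\in\mu\}$, to its quotient by $\approx$, and sends $h\colon A\to B$ to the partial function $\xi\mapsto h^{-1}(\xi)$ with domain $\bigcup_{a\in A}\widehat{h(a)}$. The functor $G\colon\mathrm{HausEt}^{\mathrm{op}}\to\mathrm{DRA}$ sends $\pi$ to the set of compact open $U\subseteq X$ on which $\pi$ is injective, with $U-V=U\setminus V$ and $U\rhd V=\pi^{-1}(\pi(U))\cap V$, and sends $\varphi$ to $U\mapsto\varphi^{-1}(U)$. There is an adjunction $F\dashv G$ with unit $a\mapsto\widehat a$ and counit given, as a morphism in $\mathrm{HausEt}$, by the partial function $x\mapsto\{U\in G(\pi)\mid x\in U\}$, defined when this set is nonempty. Fix a functional signature $\sigma$. An $n$-ary operation $\Omega$ on a difference–restriction algebra is *compatibility preserving* if $\Omega(a_1,\dots,a_n)$ and $\Omega(a_1',\dots,a_n')$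 are compatible whenever each $a_i,a_i'$ are; it is an *operator* if it is normal (its value is $0$ when some argument is $0$) and additive (in each argument, it sends any existing join $b+c$ to the join of the values at $b$ and $c$). $\mathrm{DRA}(\sigma)$ consists of the difference–restriction algebras equipped with a compatibility preserving operator for each symbol of $\sigma$, of its arity, and of all homomorphisms. For an $(n+1)$-ary relation $R$ on $X$ and $S_1,\dots,S_n\subseteq X$ let $\Omega_R(S_1,\dots,S_n)=\{x_{n+1}\mid\exists x_1\in S_1,\dots,x_n\in S_n\colon Rx_1\dots x_{n+1}\}$. The relation $R$ is *spectral* if $\Omega_R$ sends open sets to open sets and compact open sets to compact open sets; *tight* if $Rx_1\dots x_{n+1}$ holds whenever $x_{n+1}\in\Omega_R(S_1,\dots,S_n)$ for all compact open $S_1\ni x_1,\dots,S_n\ni x_n$. Write $x\mathrel Cy$ if $\pi(x)=\pi(y)$ implies $x=y$; $R$ has the *compatibility property* if $x_i\mathrel Cx_i'$ for $i\le n$, $Rx_1\dots x_{n+1}$ and $Rx_1'\dots x_{n+1}'$ imply $x_{n+1}\mathrel Cx_{n+1}'$. The objects of $\mathrm{HausEt}(\sigma)$ are the Hausdorff étale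 spaces equipped, for each symbol of $\sigma$ of arity $n$, with an $(n+1)$-ary tight spectral relation with the compatibility property. Its morphisms are the morphisms $\varphi$ of $\mathrm{HausEt}$ that satisfy, for each symbol with relations $R_X,R_Y$, the *reverse forth condition* (if $R_Xx_1\dots x_{n+1}$ and $\varphi(x_1),\dots,\varphi(x_n)$ are defined, then $\varphi(x_{n+1})$ is defined and $R_Y\varphi(x_1)\dots\varphi(x_{n+1})$) and the *back condition* (if $\varphi(x_{n+1})$ is defined and $R_Yy_1\dots y_n\varphi(x_{n+1})$, then there are $x_1,\dots,x_n$ with $\varphi(x_i)=y_i$ and $R_Xx_1\dots x_{n+1}$). **Theorem.** There is an adjunction $F'\dashv G'$ between $F'\colon\mathrm{DRA}(\sigma)\to\mathrm{HausEt}(\sigma)^{\mathrm{op}}$ and $G'\colon\mathrm{HausEt}(\sigma)^{\mathrm{op}}\to\mathrm{DRA}(\sigma)$ that extends $F\dashv G$: after forgetting the operators and relations, $F'$ and $G'$ coincide with $F$ and $G$ on objects and morphisms, and the unit and counit of $F'\dashv G'$ are those of $F\dashv G$. Here $F'(A)$ is $F(A)$ equipped, for each operator $\Omega$ of $A$, with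 the relation $R_\Omega\,\mu_1\dots\mu_{n+1}\iff\{\Omega(a_1,\dots,a_n)\mid a_i\in\mu_i\}\subseteq\mu_{n+1}$, and $G'(\pi)$ is $G(\pi)$ equipped, for each relation $R$ of $\pi$, with the operation $\Omega_R$. -/

import Mathlib

open CategoryTheory Opposite

universe u v

namespace DiffRest

/-! ## Difference-restriction algebras -/

/-- A set of pairs is a partial function. -/
def IsPartialFunction {X Y : Type u} (f : Set (X × Y)) : Prop :=
  ∀ x y z, (x, y) ∈ f → (x, z) ∈ f → y = z

/-- Domain restriction: the restriction of `g` to the domain of `f`. -/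
def domRestrict {X Y : Type u} (f g : Set (X × Y)) : Set (X × Y) :=
  {p | (∃ y, (p.1, y) ∈ f) ∧ p ∈ g}

/-- An algebra with two binary operations is representable if it is isomorphic, by `r`, to an
algebra of partial functions with relative complement and domain restriction. -/
def IsRepresentable {A : Type u} (diff rest : A → A → A) : Prop :=
  ∃ (X Y : Type u) (r : A → Set (X × Y)), Function.Injective r ∧
    (∀ a, IsPartialFunction (r a)) ∧
    (∀ a b, r (diff a b) = r a \ r b) ∧
    (∀ a b, r (rest a b) = domRestrict (r a) (r b))

/-- Difference-restriction algebras. -/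
structure DRA : Type (u + 1) where
  carrier : Type u
  diff : carrier → carrier → carrier
  restr : carrier → carrier → carrier
  nonempty : Nonempty carrier
  representable : IsRepresentable diff restr

instance : CoeSort DRA.{u} (Type u) := ⟨DRA.carrier⟩

instance (A : DRA.{u}) : Nonempty A := A.nonempty

instance (A : DRA.{u}) : Sub A := ⟨A.diff⟩

/-- The domain restriction operation of a difference-restriction algebra. -/
def rest {A : DRA.{u}} (a b : A) : A := A.restr a b

/-- The derived meet `a - (a - b)`. -/
instance (A : DRA.{u}) : Min A := ⟨fun a b => a - (a - b)⟩

/-- `a ≤ b` means `a ⊓ b = a`. -/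
instance (A : DRA.{u}) : LE A := ⟨fun a b => a ⊓ b = a⟩

/-- The zero `c - c`, which does not depend on `c`. -/
noncomputable instance (A : DRA.{u}) : Bot A :=
  ⟨Classical.arbitrary A - Classical.arbitrary A⟩

theorem exists_rep (A : DRA.{u}) : ∃ (X Y : Type u) (r : A → Set (X × Y)),
    Function.Injective r ∧ (∀ a x y z, (x, y) ∈ r a → (x, z) ∈ r a → y = z) ∧
    (∀ a b x y, (x, y) ∈ r (a - b) ↔ (x, y) ∈ r a ∧ (x, y) ∉ r b) ∧
    (∀ a b x y, (x, y) ∈ r (rest a b) ↔ (∃ z, (x, z) ∈ r a) ∧ (x, y) ∈ r b) ∧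
    (∀ a b, a ≤ b ↔ ∀ x y, (x, y) ∈ r a → (x, y) ∈ r b) ∧
    (∀ a b x y, (x, y) ∈ r (a ⊓ b) ↔ (x, y) ∈ r a ∧ (x, y) ∈ r b) ∧
    (∀ x y, (x, y) ∉ r (⊥ : A)) := by
  obtain ⟨X, Y, r, hi, hp, hd, hr⟩ := A.representable
  have hd' : ∀ a b : A, ∀ x y, (x, y) ∈ r (a - b) ↔ (x, y) ∈ r a ∧ (x, y) ∉ r b := by
    intro a b x y
    change (x, y) ∈ r (A.diff a b) ↔ _
    rw [hd]; rfl
  have hm : ∀ a b : A, ∀ x y, (x, y) ∈ r (a ⊓ b) ↔ (x, y) ∈ r a ∧ (x, y) ∈ r b := by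
    intro a b x y
    change (x, y) ∈ r (a - (a - b)) ↔ _
    rw [hd', hd']; tauto
  refine ⟨X, Y, r, hi, hp, hd', ?_, ?_, hm, ?_⟩
  · intro a b x y
    change (x, y) ∈ r (A.restr a b) ↔ _
    rw [hr]; rfl
  · intro a b
    constructor
    · intro h x y hxy
      have h' : a ⊓ b = a := h
      rw [← h', hm] at hxy
      exact hxy.2
    · intro h
      change a ⊓ b = a
      apply hi
      ext ⟨x, y⟩
      rw [hm]
      exact ⟨fun h => h.1, fun h' => ⟨h', h x y h'⟩⟩
  · intro x y h
    have h' : (x, y) ∈ r (Classical.arbitrary A - Classical.arbitrary A) := h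
    rw [hd'] at h'
    exact h'.2 h'.1

noncomputable instance (A : DRA.{u}) : SemilatticeInf A where
  le_refl a := by
    obtain ⟨X, Y, r, hi, hp, hd, hr, hle, hm, h0⟩ := exists_rep A
    rw [hle]; exact fun _ _ h => h
  le_trans a b c := by
    obtain ⟨X, Y, r, hi, hp, hd, hr, hle, hm, h0⟩ := exists_rep A
    rw [hle, hle, hle]; exact fun h h' x y hx => h' _ _ (h _ _ hx)
  le_antisymm a b := by
    obtain ⟨X, Y, r, hi, hp, hd, hr, hle, hm, h0⟩ := exists_rep A
    rw [hle, hle]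
    intro h h'
    apply hi
    ext ⟨x, y⟩
    exact ⟨h x y, h' x y⟩
  inf a b := a ⊓ b
  inf_le_left a b := by
    obtain ⟨X, Y, r, hi, hp, hd, hr, hle, hm, h0⟩ := exists_rep A
    rw [hle]; intro x y; rw [hm]; exact fun h => h.1
  inf_le_right a b := by
    obtain ⟨X, Y, r, hi, hp, hd, hr, hle, hm, h0⟩ := exists_rep A
    rw [hle]; intro x y; rw [hm]; exact fun h => h.2
  le_inf a b c := by
    obtain ⟨X, Y, r, hi, hp, hd, hr, hle, hm, h0⟩ := exists_rep A
    rw [hle, hle, hle]; intro h h' x y hx; rw [hm]; exact ⟨h _ _ hx, h' _ _ hx⟩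

noncomputable instance (A : DRA.{u}) : OrderBot A where
  bot_le a := by
    obtain ⟨X, Y, r, hi, hp, hd, hr, hle, hm, h0⟩ := exists_rep A
    rw [hle]; exact fun x y h => absurd h (h0 x y)

/-- Homomorphisms. -/
@[ext] structure DRA.Hom (A B : DRA.{u}) where
  toFun : A → B
  map_diff : ∀ a b, toFun (a - b) = toFun a - toFun b
  map_rest : ∀ a b, toFun (rest a b) = rest (toFun a) (toFun b)

/-- The category of difference-restriction algebras. -/
instance : Category DRA.{u} where
  Hom A B := DRA.Hom A B
  id A := ⟨fun a => a, fun _ _ => rfl, fun _ _ => rfl⟩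
  comp f g := ⟨fun a => g.toFun (f.toFun a),
    fun a b => by rw [f.map_diff, g.map_diff], fun a b => by rw [f.map_rest, g.map_rest]⟩

/-! ## Maximal filters -/

/-- A filter: a nonempty upward closed set closed under binary meets. -/
def IsFilter {A : DRA.{u}} (F : Set A) : Prop :=
  F.Nonempty ∧ (∀ a b, a ∈ F → a ≤ b → b ∈ F) ∧ (∀ a b, a ∈ F → b ∈ F → a ⊓ b ∈ F)

/-- A maximal filter: maximal with respect to inclusion among the proper filters. -/
def IsMaximalFilter {A : DRA.{u}} (F : Set A) : Prop :=
  Maximal (fun G : Set A => IsFilter G ∧ G ≠ Set.univ) F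

/-- The set of maximal filters. -/
def MaxFilter (A : DRA.{u}) : Type u := {F : Set A // IsMaximalFilter F}

instance (A : DRA.{u}) : Membership A (MaxFilter A) := ⟨fun μ a => a ∈ μ.1⟩

theorem MaxFilter.ext {A : DRA.{u}} {μ ν : MaxFilter A} (h : ∀ a, a ∈ μ ↔ a ∈ ν) : μ = ν :=
  Subtype.ext (Set.ext h)

section facts
variable {A : DRA.{u}}

theorem MaxFilter.mem_of_le (μ : MaxFilter A) {a b : A} (ha : a ∈ μ) (h : a ≤ b) : b ∈ μ :=
  μ.2.prop.1.2.1 a b ha h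

theorem MaxFilter.inf_mem (μ : MaxFilter A) {a b : A} (ha : a ∈ μ) (hb : b ∈ μ) : a ⊓ b ∈ μ :=
  μ.2.prop.1.2.2 a b ha hb

theorem MaxFilter.exists_mem (μ : MaxFilter A) : ∃ a, a ∈ μ := μ.2.prop.1.1

theorem MaxFilter.bot_not_mem (μ : MaxFilter A) : (⊥ : A) ∉ μ := fun h =>
  μ.2.prop.2 (Set.eq_univ_of_forall fun _ => μ.mem_of_le h bot_le)

theorem MaxFilter.prime (μ : MaxFilter A) {a : A} (ha : a ∈ μ) (b : A) :
    a ⊓ b ∈ μ ∨ a - b ∈ μ := by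
  by_contra! hcon
  obtain ⟨h1, h2⟩ := hcon
  let G : Set A := {c | ∃ m ∈ μ, m ⊓ b ≤ c}
  have hG : IsFilter G := by
    refine ⟨⟨a, a, ha, inf_le_left⟩, fun c d ⟨m, hm, h⟩ hcd => ⟨m, hm, h.trans hcd⟩, ?_⟩
    rintro c d ⟨m, hm, h⟩ ⟨m', hm', h'⟩
    exact ⟨m ⊓ m', μ.inf_mem hm hm',
      le_inf ((inf_le_inf_right b inf_le_left).trans h)
        ((inf_le_inf_right b inf_le_right).trans h')⟩
  have hG' : G ≠ Set.univ := by
    intro h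
    obtain ⟨m, hm, hle0⟩ : (⊥ : A) ∈ G := h ▸ Set.mem_univ _
    refine h2 (μ.mem_of_le (μ.inf_mem hm ha) ?_)
    obtain ⟨X, Y, r, hi, hp, hd, hr, hle, hm, h0⟩ := exists_rep A
    rw [hle] at hle0 ⊢
    intro x y
    have := hle0 x y
    have := h0 x y
    rw [hm] at *
    rw [hd]
    tauto
  have hsub : G ⊆ μ.1 := μ.2.le_of_ge ⟨hG, hG'⟩ fun m hm => ⟨m, hm, inf_le_left⟩
  exact h1 (μ.inf_mem ha (hsub ⟨a, ha, inf_le_right⟩))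

theorem isMaximalFilter_of_prime {F : Set A} (hF : IsFilter F) (h0 : (⊥ : A) ∉ F)
    (hp : ∀ a ∈ F, ∀ b, a ⊓ b ∈ F ∨ a - b ∈ F) : IsMaximalFilter F := by
  refine ⟨⟨hF, fun h => h0 (h ▸ Set.mem_univ _)⟩, ?_⟩
  rintro G ⟨hG, hG'⟩ hFG b hb
  obtain ⟨a, ha⟩ := hF.1
  rcases hp a ha b with h | h
  · exact hF.2.1 _ _ h inf_le_right
  · exfalso
    apply hG'
    have h1 : (a - b) ⊓ b ∈ G := hG.2.2 _ _ (hFG h) hb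
    refine Set.eq_univ_of_forall fun c => hG.2.1 _ c h1 ?_
    obtain ⟨X, Y, r, hi, hp, hd, hr, hle, hm, h0⟩ := exists_rep A
    rw [hle]
    intro x y
    rw [hm, hd]
    tauto

/-- `μ ≈ ν` if `rest a b ∈ ν` for all `a ∈ μ` and `b ∈ ν`. -/
def FilterEquiv (μ ν : MaxFilter A) : Prop := ∀ a ∈ μ, ∀ b ∈ ν, rest a b ∈ ν

theorem FilterEquiv.refl (μ : MaxFilter A) : FilterEquiv μ μ := by
  intro a ha b hb
  refine μ.mem_of_le (μ.inf_mem ha hb) ?_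
  obtain ⟨X, Y, r, hi, hp, hd, hr, hle, hm, h0⟩ := exists_rep A
  rw [hle]
  intro x y
  rw [hm, hr]
  exact fun h => ⟨⟨y, h.1⟩, h.2⟩

theorem FilterEquiv.symm {μ ν : MaxFilter A} (h : FilterEquiv μ ν) : FilterEquiv ν μ := by
  intro b hb a ha
  rcases μ.prime ha (rest b a) with h1 | h1
  · exact μ.mem_of_le h1 inf_le_right
  · exfalso
    refine ν.bot_not_mem (ν.mem_of_le (h _ h1 b hb) ?_)
    obtain ⟨X, Y, r, hi, hp, hd, hr, hle, hm, h0⟩ := exists_rep A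
    rw [hle]
    intro x y
    simp only [hr, hd]
    grind

theorem FilterEquiv.trans {μ ν ξ : MaxFilter A} (h : FilterEquiv μ ν) (h' : FilterEquiv ν ξ) :
    FilterEquiv μ ξ := by
  intro a ha c hc
  obtain ⟨b, hb⟩ := ν.exists_mem
  refine ξ.mem_of_le (h' _ (h a ha b hb) c hc) ?_
  obtain ⟨X, Y, r, hi, hp, hd, hr, hle, hm, h0⟩ := exists_rep A
  rw [hle]
  intro x y
  simp only [hr]
  grind

theorem FilterEquiv.eq_of_mem {μ ν : MaxFilter A} (h : FilterEquiv μ ν) {c : A} (hc : c ∈ μ)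
    (hc' : c ∈ ν) : μ = ν := by
  have key : ∀ {μ ν : MaxFilter A}, FilterEquiv μ ν → c ∈ μ → c ∈ ν → ∀ b ∈ μ, b ∈ ν := by
    intro μ ν h hc hc' b hb
    refine ν.mem_of_le (h _ (μ.inf_mem hb hc) c hc') ?_
    obtain ⟨X, Y, r, hi, hp, hd, hr, hle, hm, h0⟩ := exists_rep A
    rw [hle]
    intro x y
    simp only [hr, hm]
    grind
  exact MaxFilter.ext fun b => ⟨key h hc hc' b, key h.symm hc' hc b⟩

/-- If the domain of `e` meets `ξ`, then some maximal filter equivalent to `ξ` contains `e`. -/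
theorem exists_equiv_mem (ξ : MaxFilter A) (e d₀ : A) (he : rest e d₀ ∈ ξ) :
    ∃ μ : MaxFilter A, FilterEquiv ξ μ ∧ e ∈ μ := by
  have hed : ∀ d ∈ ξ, rest e d ∈ ξ := by
    intro d hd
    refine ξ.mem_of_le (ξ.inf_mem he hd) ?_
    obtain ⟨X, Y, r, hi, hp, hd, hr, hle, hm, h0⟩ := exists_rep A
    rw [hle]
    intro x y
    simp only [hr, hm]
    tauto
  let G : Set A := {c | ∃ d ∈ ξ, rest d e ≤ c}
  have hG : IsFilter G := by
    refine ⟨⟨rest (rest e d₀) e, _, he, le_rfl⟩,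
      fun c d ⟨m, hm, h⟩ hcd => ⟨m, hm, h.trans hcd⟩, ?_⟩
    rintro c d ⟨m, hm, h⟩ ⟨m', hm', h'⟩
    refine ⟨m ⊓ m', ξ.inf_mem hm hm', le_inf (le_trans ?_ h) (le_trans ?_ h')⟩
    all_goals
      obtain ⟨X, Y, r, hi, hp, hd, hr, hle, hm, h0⟩ := exists_rep A
      rw [hle]
      intro x y
      simp only [hr, hm]
      grind
  have hmax : IsMaximalFilter G := by
    refine isMaximalFilter_of_prime hG ?_ ?_
    · rintro ⟨d, hd, hle0⟩
      refine ξ.bot_not_mem (ξ.mem_of_le (hed d hd) ?_)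
      obtain ⟨X, Y, r, hi, hp, hd, hr, hle, hm, h0⟩ := exists_rep A
      rw [hle] at hle0 ⊢
      intro x y
      simp only [hr] at hle0 ⊢
      grind
    · rintro c ⟨d, hd, hc⟩ b
      rcases ξ.prime (hed d hd) (rest (rest d e ⊓ b) d) with h | h
      · refine Or.inl ⟨_, h, ?_⟩
        obtain ⟨X, Y, r, hi, hp, hd, hr, hle, hm, h0⟩ := exists_rep A
        rw [hle] at hc ⊢
        intro x y
        simp only [hr, hm] at hc ⊢
        grind
      · refine Or.inr ⟨_, h, ?_⟩
        obtain ⟨X, Y, r, hi, hp, hd, hr, hle, hm, h0⟩ := exists_rep A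
        rw [hle] at hc ⊢
        intro x y
        simp only [hr, hm, hd] at hc ⊢
        grind
  refine ⟨⟨G, hmax⟩, ?_, ⟨d₀, ξ.mem_of_le he ?_, ?_⟩⟩
  · rintro b hb c ⟨d, hd, hc⟩
    refine ⟨b ⊓ d, ξ.inf_mem hb hd, ?_⟩
    obtain ⟨X, Y, r, hi, hp, hd, hr, hle, hm, h0⟩ := exists_rep A
    rw [hle] at hc ⊢
    intro x y
    simp only [hr, hm] at hc ⊢
    grind
  all_goals
    obtain ⟨X, Y, r, hi, hp, hd, hr, hle, hm, h0⟩ := exists_rep A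
    rw [hle]
    intro x y
    simp only [hr]
    tauto

end facts

/-- The equivalence relation `≈` on maximal filters. -/
instance filterSetoid (A : DRA.{u}) : Setoid (MaxFilter A) where
  r := FilterEquiv
  iseqv := ⟨FilterEquiv.refl, FilterEquiv.symm, FilterEquiv.trans⟩

/-- The set of maximal filters containing `a`. -/
def hat {A : DRA.{u}} (a : A) : Set (MaxFilter A) := {μ | a ∈ μ}

/-- The topology on the maximal filters generated by the sets `hat a`. -/
instance (A : DRA.{u}) : TopologicalSpace (MaxFilter A) :=
  TopologicalSpace.generateFrom (Set.range (hat (A := A)))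

/-! ## Hausdorff étale spaces -/

/-- Hausdorff étale spaces: surjective local homeomorphisms between Hausdorff spaces. -/
structure HausEt : Type (u + 1) where
  X : Type u
  X₀ : Type u
  [topX : TopologicalSpace X]
  [topX₀ : TopologicalSpace X₀]
  [t2X : T2Space X]
  [t2X₀ : T2Space X₀]
  π : X → X₀
  isLocalHomeomorph : IsLocalHomeomorph π
  surjective : Function.Surjective π

attribute [instance] HausEt.topX HausEt.topX₀ HausEt.t2X HausEt.t2X₀

/-- Morphisms of Hausdorff étale spaces: continuous and proper partial functions that preserve
equivalence and are fibrewise injective and fibrewise surjective. -/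
@[ext] structure HausEt.Hom (E D : HausEt.{u}) where
  toPFun : E.X →. D.X
  continuous : ∀ V : Set D.X, IsOpen V → IsOpen (toPFun.preimage V)
  proper : ∀ K : Set D.X, IsCompact K → IsCompact (toPFun.preimage K)
  preserves_equiv : ∀ x x' y y', y ∈ toPFun x → y' ∈ toPFun x' → E.π x = E.π x' → D.π y = D.π y'
  fibre_injective : ∀ x x' y, y ∈ toPFun x → y ∈ toPFun x' → E.π x = E.π x' → x = x'
  fibre_surjective : ∀ x y y', y ∈ toPFun x → D.π y = D.π y' →
    ∃ x', E.π x' = E.π x ∧ y' ∈ toPFun x'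

theorem preimage_id {X : Type u} (V : Set X) : (PFun.id X).preimage V = V := by
  ext x
  rw [PFun.mem_preimage]
  constructor
  · rintro ⟨y, hy, hyx⟩
    exact (Part.mem_some_iff.mp hyx) ▸ hy
  · exact fun hx => ⟨x, hx, Part.mem_some x⟩

/-- The category of Hausdorff étale spaces. -/
instance : Category HausEt.{u} where
  Hom E D := HausEt.Hom E D
  id E :=
    { toPFun := PFun.id E.X
      continuous := fun V hV => by rw [preimage_id]; exact hV
      proper := fun V hV => by rw [preimage_id]; exact hV
      preserves_equiv := by
        intro x x' y y' h h' hx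
        rw [PFun.id_apply, Part.mem_some_iff] at h h'
        rw [h, h', hx]
      fibre_injective := by
        intro x x' y h h' _
        rw [PFun.id_apply, Part.mem_some_iff] at h h'
        rw [← h, ← h']
      fibre_surjective := by
        intro x y y' h hy
        rw [PFun.id_apply, Part.mem_some_iff] at h
        exact ⟨y', by rw [← hy, h], by rw [PFun.id_apply]; exact Part.mem_some y'⟩ }
  comp {E D C} f g :=
    { toPFun := g.toPFun.comp f.toPFun
      continuous := fun V hV => by
        rw [PFun.preimage_comp]; exact f.continuous _ (g.continuous _ hV)
      proper := fun V hV => by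
        rw [PFun.preimage_comp]; exact f.proper _ (g.proper _ hV)
      preserves_equiv := by
        intro x x' z z' h h' hx
        obtain ⟨y, hy, hz⟩ := Part.mem_bind_iff.mp h
        obtain ⟨y', hy', hz'⟩ := Part.mem_bind_iff.mp h'
        exact g.preserves_equiv _ _ _ _ hz hz' (f.preserves_equiv _ _ _ _ hy hy' hx)
      fibre_injective := by
        intro x x' z h h' hx
        obtain ⟨y, hy, hz⟩ := Part.mem_bind_iff.mp h
        obtain ⟨y', hy', hz'⟩ := Part.mem_bind_iff.mp h'
        have hyy := g.fibre_injective _ _ _ hz hz' (f.preserves_equiv _ _ _ _ hy hy' hx)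
        subst hyy
        exact f.fibre_injective _ _ _ hy hy' hx
      fibre_surjective := by
        intro x z z' h hz'
        obtain ⟨y, hy, hz⟩ := Part.mem_bind_iff.mp h
        obtain ⟨y', hyy', hzy'⟩ := g.fibre_surjective _ _ _ hz hz'
        obtain ⟨x', hxx', hyx'⟩ := f.fibre_surjective _ _ _ hy hyy'.symm
        exact ⟨x', hxx', Part.mem_bind_iff.mpr ⟨y', hyx', hzy'⟩⟩ }
  id_comp f := HausEt.Hom.ext (PFun.comp_id _)
  comp_id f := HausEt.Hom.ext (PFun.id_comp _)
  assoc f g h := HausEt.Hom.ext (PFun.comp_assoc h.toPFun g.toPFun f.toPFun).symm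

/-! ## The functor from algebras to spaces -/

section spec
variable {A : DRA.{u}}

theorem isOpen_hat (a : A) : IsOpen (hat a) :=
  TopologicalSpace.isOpen_generateFrom_of_mem ⟨a, rfl⟩

theorem hat_inf (a b : A) : hat (a ⊓ b) = hat a ∩ hat b := by
  ext μ
  exact ⟨fun h => ⟨μ.mem_of_le h inf_le_left, μ.mem_of_le h inf_le_right⟩,
    fun h => μ.inf_mem h.1 h.2⟩

theorem isBasis_hat (A : DRA.{u}) :
    TopologicalSpace.IsTopologicalBasis (Set.range (hat (A := A))) where
  exists_subset_inter := by
    rintro _ ⟨a, rfl⟩ _ ⟨b, rfl⟩ μ h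
    exact ⟨hat (a ⊓ b), ⟨_, rfl⟩, by rw [hat_inf]; exact h, by rw [hat_inf]⟩
  sUnion_eq := by
    refine Set.eq_univ_of_forall fun μ => ?_
    obtain ⟨a, ha⟩ := μ.exists_mem
    exact ⟨hat a, ⟨a, rfl⟩, ha⟩
  eq_generateFrom := rfl

theorem isCompact_hat (a : A) : IsCompact (hat a) := by
  rw [isCompact_iff_ultrafilter_le_nhds]
  intro f hf
  have hfa : hat a ∈ f := Filter.le_principal_iff.mp hf
  have hmax : IsMaximalFilter {b : A | hat b ∈ f} := by
    refine isMaximalFilter_of_prime ⟨⟨a, hfa⟩, ?_, ?_⟩ ?_ ?_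
    · exact fun b c hb hbc => Filter.mem_of_superset hb fun μ hμ => μ.mem_of_le hμ hbc
    · intro b c hb hc
      change hat (b ⊓ c) ∈ f
      rw [hat_inf]
      exact Filter.inter_mem hb hc
    · intro h
      have : hat (⊥ : A) = ∅ := Set.eq_empty_of_forall_notMem fun μ hμ => μ.bot_not_mem hμ
      have h' : hat (⊥ : A) ∈ f := h
      rw [this] at h'
      exact Ultrafilter.empty_notMem h'
    · intro b hb c
      have : hat (b ⊓ c) ∪ hat (b - c) ∈ f :=
        Filter.mem_of_superset hb fun μ hμ => μ.prime hμ c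
      exact Ultrafilter.union_mem_iff.mp this
  let μ : MaxFilter A := ⟨_, hmax⟩
  refine ⟨μ, hfa, ?_⟩
  rw [TopologicalSpace.nhds_generateFrom]
  refine le_iInf₂ fun s hs => ?_
  obtain ⟨hμ, b, rfl⟩ := hs
  exact Filter.le_principal_iff.mpr hμ

/-- The canonical quotient of the space of maximal filters. -/
def specMk (μ : MaxFilter A) : Quotient (filterSetoid A) := Quotient.mk _ μ

theorem specMk_eq {μ ν : MaxFilter A} : specMk μ = specMk ν ↔ FilterEquiv μ ν := Quotient.eq

theorem continuous_specMk : Continuous (specMk (A := A)) := continuous_quotient_mk'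

theorem isOpenMap_specMk : IsOpenMap (specMk (A := A)) := by
  rw [(isBasis_hat A).isOpenMap_iff]
  rintro _ ⟨a, rfl⟩
  change IsOpen (specMk ⁻¹' (specMk '' hat a))
  have : specMk ⁻¹' (specMk '' hat a) = ⋃ b : A, hat (rest a b) := by
    ext ν
    simp only [Set.mem_preimage, Set.mem_image, Set.mem_iUnion]
    constructor
    · rintro ⟨μ, ha, h⟩
      obtain ⟨b, hb⟩ := ν.exists_mem
      exact ⟨b, specMk_eq.mp h a ha b hb⟩
    · rintro ⟨b, hb⟩
      obtain ⟨μ, h, ha⟩ := exists_equiv_mem ν a b hb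
      exact ⟨μ, ha, (specMk_eq.mpr h).symm⟩
  rw [this]
  exact isOpen_iUnion fun b => isOpen_hat _

theorem disjoint_specMk_hat {a b : A} (h : rest a b = ⊥) :
    Disjoint (specMk '' hat a) (specMk '' hat b) := by
  rw [Set.disjoint_left]
  rintro _ ⟨μ, ha, rfl⟩ ⟨ν, hb, hν⟩
  have := specMk_eq.mp hν.symm a ha b hb
  rw [h] at this
  exact ν.bot_not_mem this

/-- Maximal filters in distinct classes contain elements with disjoint domains. -/
theorem exists_rest_eq_bot {μ ν : MaxFilter A} (h : ¬ FilterEquiv μ ν) :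
    ∃ a ∈ μ, ∃ b ∈ ν, rest a b = ⊥ := by
  simp only [FilterEquiv, not_forall] at h
  obtain ⟨a, ha, b, hb, hab⟩ := h
  rcases ν.prime hb (rest a b) with h1 | h1
  · exact absurd (ν.mem_of_le h1 inf_le_right) hab
  · refine ⟨a, ha, _, h1, le_bot_iff.mp ?_⟩
    obtain ⟨X, Y, r, hi, hp, hd, hr, hle, hm, h0⟩ := exists_rep A
    rw [hle]
    intro x y
    simp only [hr, hd]
    grind

instance : T2Space (Quotient (filterSetoid A)) where
  t2 := by
    intro p q hpq
    induction p using Quotient.inductionOn with | _ μ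
    induction q using Quotient.inductionOn with | _ ν
    obtain ⟨a, ha, b, hb, hab⟩ := exists_rest_eq_bot (mt specMk_eq.mpr hpq)
    exact ⟨_, _, isOpenMap_specMk _ (isOpen_hat a), isOpenMap_specMk _ (isOpen_hat b),
      ⟨μ, ha, rfl⟩, ⟨ν, hb, rfl⟩, disjoint_specMk_hat hab⟩

instance : T2Space (MaxFilter A) where
  t2 := by
    intro μ ν hne
    by_cases h : FilterEquiv μ ν
    · obtain ⟨a, ha⟩ := μ.exists_mem
      obtain ⟨b, hb⟩ := ν.exists_mem
      have hbμ : a ⊓ b ∉ μ := fun hab =>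
        hne (h.eq_of_mem (μ.mem_of_le hab inf_le_right) hb)
      have h1 := (μ.prime ha b).resolve_left hbμ
      refine ⟨hat (a - b), hat b, isOpen_hat _, isOpen_hat _, h1, hb, ?_⟩
      rw [Set.disjoint_left]
      intro ξ hξ hξ'
      refine ξ.bot_not_mem (ξ.mem_of_le (ξ.inf_mem hξ hξ') ?_)
      obtain ⟨X, Y, r, hi, hp, hd, hr, hle, hm, h0⟩ := exists_rep A
      rw [hle]
      intro x y
      simp only [hm, hd]
      tauto
    · obtain ⟨a, ha, b, hb, hab⟩ := exists_rest_eq_bot h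
      refine ⟨hat a, hat b, isOpen_hat _, isOpen_hat _, ha, hb, ?_⟩
      exact (disjoint_specMk_hat hab).of_image

theorem isLocalHomeomorph_specMk : IsLocalHomeomorph (specMk (A := A)) := by
  rw [isLocalHomeomorph_iff_isOpenEmbedding_restrict]
  intro μ
  obtain ⟨a, ha⟩ := μ.exists_mem
  refine ⟨hat a, (isOpen_hat a).mem_nhds ha, ?_⟩
  refine Topology.IsOpenEmbedding.of_continuous_injective_isOpenMap
    (continuous_specMk.comp continuous_subtype_val) ?_
    (isOpenMap_specMk.domRestrict (isOpen_hat a))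
  intro ξ ξ' h
  exact Subtype.ext ((specMk_eq.mp h).eq_of_mem ξ.2 ξ'.2)

end spec

/-- The Hausdorff étale space of a difference-restriction algebra: the canonical quotient map on
the maximal filters. -/
def specObj (A : DRA.{u}) : HausEt.{u} where
  X := MaxFilter A
  X₀ := Quotient (filterSetoid A)
  π := specMk
  isLocalHomeomorph := isLocalHomeomorph_specMk
  surjective := Quotient.mk_surjective

section specMap
variable {A B : DRA.{u}} (h : DRA.Hom A B)

theorem map_inf (a b : A) : h.toFun (a ⊓ b) = h.toFun a ⊓ h.toFun b := by
  change h.toFun (a - (a - b)) = h.toFun a - (h.toFun a - h.toFun b)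
  rw [h.map_diff, h.map_diff]

theorem map_mono {a b : A} (hab : a ≤ b) : h.toFun a ≤ h.toFun b := by
  rw [← inf_eq_left] at hab ⊢
  rw [← map_inf, hab]

theorem map_bot : h.toFun ⊥ = ⊥ := by
  change h.toFun (Classical.arbitrary A - Classical.arbitrary A) = ⊥
  rw [h.map_diff]
  obtain ⟨X, Y, r, hi, hp, hd, hr, hle, hm, h0⟩ := exists_rep B
  rw [← le_bot_iff, hle]
  intro x y
  rw [hd]
  tauto

theorem isMaximalFilter_comap (ξ : MaxFilter B) (hξ : ∃ a, h.toFun a ∈ ξ) :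
    IsMaximalFilter {a | h.toFun a ∈ ξ} := by
  refine isMaximalFilter_of_prime ⟨hξ, ?_, ?_⟩ ?_ ?_
  · exact fun a b ha hab => ξ.mem_of_le ha (map_mono h hab)
  · intro a b ha hb
    change h.toFun (a ⊓ b) ∈ ξ
    rw [map_inf]
    exact ξ.inf_mem ha hb
  · intro h0
    have h0' : h.toFun ⊥ ∈ ξ := h0
    rw [map_bot] at h0'
    exact ξ.bot_not_mem h0'
  · intro a ha b
    change h.toFun (a ⊓ b) ∈ ξ ∨ h.toFun (a - b) ∈ ξ
    rw [map_inf, h.map_diff]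
    exact ξ.prime ha _

/-- The partial function `ξ ↦ h⁻¹(ξ)`, defined on those `ξ` that contain some `h a`. -/
def comapPFun : MaxFilter B →. MaxFilter A := fun ξ =>
  ⟨∃ a, h.toFun a ∈ ξ, fun hξ => ⟨{a | h.toFun a ∈ ξ}, isMaximalFilter_comap h ξ hξ⟩⟩

theorem mem_comapPFun {ξ : MaxFilter B} {μ : MaxFilter A} :
    μ ∈ comapPFun h ξ ↔ ∀ a, a ∈ μ ↔ h.toFun a ∈ ξ := by
  constructor
  · rintro ⟨hξ, rfl⟩ a
    rfl
  · intro hμ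
    obtain ⟨a, ha⟩ := μ.exists_mem
    exact ⟨⟨a, (hμ a).mp ha⟩, MaxFilter.ext fun a => (hμ a).symm⟩

theorem preimage_comapPFun_hat (a : A) : (comapPFun h).preimage (hat a) = hat (h.toFun a) := by
  ext ξ
  rw [PFun.mem_preimage]
  constructor
  · rintro ⟨μ, ha, hμ⟩
    exact ((mem_comapPFun h).mp hμ a).mp ha
  · intro ha
    exact ⟨⟨{a | h.toFun a ∈ ξ}, isMaximalFilter_comap h ξ ⟨a, ha⟩⟩, ha,
      (mem_comapPFun h).mpr fun _ => Iff.rfl⟩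

theorem isOpen_preimage_comapPFun {V : Set (MaxFilter A)} (hV : IsOpen V) :
    IsOpen ((comapPFun h).preimage V) := by
  rw [isOpen_iff_forall_mem_open]
  intro ξ hξ
  rw [PFun.mem_preimage] at hξ
  obtain ⟨μ, hμV, hμ⟩ := hξ
  obtain ⟨_, ⟨a, rfl⟩, ha, haV⟩ := (isBasis_hat A).exists_subset_of_mem_open hμV hV
  refine ⟨hat (h.toFun a), ?_, isOpen_hat _, ((mem_comapPFun h).mp hμ a).mp ha⟩
  rw [← preimage_comapPFun_hat]
  exact PFun.preimage_mono _ haV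

theorem isCompact_preimage_comapPFun {K : Set (MaxFilter A)} (hK : IsCompact K) :
    IsCompact ((comapPFun h).preimage K) := by
  obtain ⟨t, ht⟩ := hK.elim_finite_subcover (fun a : A => hat a) isOpen_hat
    (fun μ _ => by obtain ⟨a, ha⟩ := μ.exists_mem; exact Set.mem_iUnion.mpr ⟨a, ha⟩)
  have hc : IsCompact (⋃ a ∈ t, hat (h.toFun a)) :=
    t.isCompact_biUnion fun a _ => isCompact_hat _
  have : (comapPFun h).preimage K =
      (⋃ a ∈ t, hat (h.toFun a)) \ (comapPFun h).preimage Kᶜ := by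
    ext ξ
    simp only [PFun.mem_preimage, Set.mem_sdiff, Set.mem_iUnion]
    constructor
    · rintro ⟨μ, hμK, hμ⟩
      refine ⟨?_, ?_⟩
      · obtain ⟨a, hat, ha⟩ := Set.mem_iUnion₂.mp (ht hμK)
        exact ⟨a, hat, ((mem_comapPFun h).mp hμ a).mp ha⟩
      · rintro ⟨ν, hν, hν'⟩
        exact hν (Part.mem_unique hμ hν' ▸ hμK)
    · rintro ⟨⟨a, _, ha⟩, hn⟩
      refine ⟨⟨{a | h.toFun a ∈ ξ}, isMaximalFilter_comap h ξ ⟨a, ha⟩⟩, ?_,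
        (mem_comapPFun h).mpr fun _ => Iff.rfl⟩
      by_contra hK'
      exact hn ⟨_, hK', (mem_comapPFun h).mpr fun _ => Iff.rfl⟩
  rw [this]
  exact hc.diff (isOpen_preimage_comapPFun h hK.isClosed.isOpen_compl)

theorem comapPFun_equiv {ξ ξ' : MaxFilter B} {μ μ' : MaxFilter A} (hμ : μ ∈ comapPFun h ξ)
    (hμ' : μ' ∈ comapPFun h ξ') (hξ : FilterEquiv ξ ξ') : FilterEquiv μ μ' := by
  rw [mem_comapPFun] at hμ hμ'
  intro a ha b hb
  rw [hμ', h.map_rest]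
  exact hξ _ ((hμ a).mp ha) _ ((hμ' b).mp hb)

/-- The morphism of Hausdorff étale spaces induced by a homomorphism. -/
def specMap : HausEt.Hom (specObj B) (specObj A) where
  toPFun := comapPFun h
  continuous V hV := isOpen_preimage_comapPFun h hV
  proper K hK := isCompact_preimage_comapPFun h hK
  preserves_equiv ξ ξ' μ μ' hμ hμ' hξ :=
    specMk_eq.mpr (comapPFun_equiv h hμ hμ' (specMk_eq.mp hξ))
  fibre_injective ξ ξ' μ hμ hμ' hξ := by
    obtain ⟨a, ha⟩ := MaxFilter.exists_mem (A := A) μ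
    exact (specMk_eq.mp hξ).eq_of_mem (((mem_comapPFun h).mp hμ a).mp ha)
      (((mem_comapPFun h).mp hμ' a).mp ha)
  fibre_surjective ξ μ μ' hμ hμ' := by
    have he : FilterEquiv (A := A) μ' μ := (specMk_eq.mp hμ').symm
    obtain ⟨a, ha⟩ := MaxFilter.exists_mem (A := A) μ'
    obtain ⟨b, hb⟩ := MaxFilter.exists_mem (A := A) μ
    have h1 : h.toFun (rest a b) ∈ (show MaxFilter B from ξ) :=
      ((mem_comapPFun h).mp hμ _).mp (he a ha b hb)
    rw [h.map_rest] at h1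
    obtain ⟨ξ', hξ', ha'⟩ := exists_equiv_mem (A := B) ξ _ _ h1
    have hν : (⟨{a | h.toFun a ∈ ξ'}, isMaximalFilter_comap h ξ' ⟨a, ha'⟩⟩ : MaxFilter A) ∈
        comapPFun h ξ' := (mem_comapPFun h).mpr fun _ => Iff.rfl
    have heq := ((comapPFun_equiv h hμ hν hξ').symm.trans he.symm).eq_of_mem (c := a) ha' ha
    exact ⟨ξ', (specMk_eq.mpr hξ').symm, heq ▸ hν⟩

end specMap

/-- The functor `F` from difference-restriction algebras to the opposite of the category of
Hausdorff étale spaces. -/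
def F : DRA.{u} ⥤ HausEt.{u}ᵒᵖ where
  obj A := op (specObj A)
  map {A B} h := Quiver.Hom.op (X := specObj B) (Y := specObj A) (specMap h)
  map_id A := by
    apply Quiver.Hom.unop_inj
    refine HausEt.Hom.ext (PFun.ext fun (ξ : MaxFilter A) (μ : MaxFilter A) => ?_)
    refine (mem_comapPFun _).trans (Iff.trans ?_ Part.mem_some_iff.symm)
    exact ⟨fun h => MaxFilter.ext h, fun h => h ▸ fun _ => Iff.rfl⟩
  map_comp {A B C} f g := by
    apply Quiver.Hom.unop_inj
    refine HausEt.Hom.ext (PFun.ext fun (ξ : MaxFilter C) (μ : MaxFilter A) => ?_)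
    refine (mem_comapPFun _).trans (Iff.trans ?_ Part.mem_bind_iff.symm)
    constructor
    · intro h
      obtain ⟨a, ha⟩ := μ.exists_mem
      exact ⟨⟨_, isMaximalFilter_comap g ξ ⟨f.toFun a, (h a).mp ha⟩⟩,
        (mem_comapPFun g).mpr fun _ => Iff.rfl, (mem_comapPFun f).mpr h⟩
    · rintro ⟨ν, hν, hμ⟩ a
      exact ((mem_comapPFun f).mp hμ a).trans ((mem_comapPFun g).mp hν _)

/-! ## The functor from spaces to algebras -/

/-- The compact open sets on which `π` is injective. -/
def KO (E : HausEt.{u}) : Type u :=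
  {U : Set E.X // IsCompact U ∧ IsOpen U ∧ Set.InjOn E.π U}

/-- The difference-restriction algebra of compact open sets on which `π` is injective. -/
def koObj (E : HausEt.{u}) : DRA.{u} where
  carrier := KO E
  diff U V := ⟨U.1 \ V.1, U.2.1.diff V.2.2.1, U.2.2.1.sdiff V.2.1.isClosed,
    U.2.2.2.mono Set.sdiff_subset⟩
  restr U V := ⟨E.π ⁻¹' (E.π '' U.1) ∩ V.1,
    V.2.1.inter_left
      ((U.2.1.image E.isLocalHomeomorph.continuous).isClosed.preimage
        E.isLocalHomeomorph.continuous),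
    ((E.isLocalHomeomorph.isOpenMap _ U.2.2.1).preimage E.isLocalHomeomorph.continuous).inter
      V.2.2.1,
    V.2.2.2.mono Set.inter_subset_right⟩
  nonempty := ⟨⟨∅, isCompact_empty, isOpen_empty, Set.injOn_empty _⟩⟩
  representable := by
    refine ⟨E.X₀, E.X, fun U => {p | p.2 ∈ U.1 ∧ E.π p.2 = p.1}, ?_, ?_, ?_, ?_⟩
    · intro U V h
      apply Subtype.ext
      ext x
      have := Set.ext_iff.mp h (E.π x, x)
      simpa using this
    · rintro U x y z ⟨hy, h⟩ ⟨hz, h'⟩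
      exact U.2.2.2 hy hz (h.trans h'.symm)
    · intro U V
      ext ⟨x, y⟩
      simp only [Set.mem_ofPred_eq, Set.mem_sdiff]
      tauto
    · intro U V
      ext ⟨x, y⟩
      simp only [domRestrict, Set.mem_ofPred_eq, Set.mem_inter_iff, Set.mem_preimage, Set.mem_image]
      grind

section koMap
variable {E D : HausEt.{u}} (φ : HausEt.Hom E D)

theorem injOn_preimage {U : Set D.X} (hU : Set.InjOn D.π U) :
    Set.InjOn E.π (φ.toPFun.preimage U) := by
  intro x hx x' hx' h
  rw [PFun.mem_preimage] at hx hx'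
  obtain ⟨y, hyU, hy⟩ := hx
  obtain ⟨y', hyU', hy'⟩ := hx'
  have := hU hyU hyU' (φ.preserves_equiv _ _ _ _ hy hy' h)
  subst this
  exact φ.fibre_injective _ _ _ hy hy' h

/-- The homomorphism `U ↦ φ⁻¹(U)` induced by a morphism `φ`. -/
def koMap : DRA.Hom (koObj D) (koObj E) where
  toFun U := ⟨φ.toPFun.preimage U.1, φ.proper _ U.2.1, φ.continuous _ U.2.2.1,
    injOn_preimage φ U.2.2.2⟩
  map_diff U V := by
    apply Subtype.ext
    change φ.toPFun.preimage (U.1 \ V.1) = φ.toPFun.preimage U.1 \ φ.toPFun.preimage V.1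
    ext x
    simp only [PFun.mem_preimage, Set.mem_sdiff]
    constructor
    · rintro ⟨y, hy, hyx⟩
      exact ⟨⟨y, hy.1, hyx⟩, fun ⟨y', hy', hyx'⟩ => hy.2 (Part.mem_unique hyx hyx' ▸ hy')⟩
    · rintro ⟨⟨y, hy, hyx⟩, h⟩
      exact ⟨y, ⟨hy, fun hy' => h ⟨y, hy', hyx⟩⟩, hyx⟩
  map_rest U V := by
    apply Subtype.ext
    change φ.toPFun.preimage (D.π ⁻¹' (D.π '' U.1) ∩ V.1) =
      E.π ⁻¹' (E.π '' φ.toPFun.preimage U.1) ∩ φ.toPFun.preimage V.1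
    ext x
    simp only [PFun.mem_preimage, Set.mem_inter_iff, Set.mem_preimage, Set.mem_image]
    constructor
    · rintro ⟨y, ⟨⟨z, hz, hzy⟩, hy⟩, hyx⟩
      obtain ⟨x', hx', hzx'⟩ := φ.fibre_surjective _ _ _ hyx hzy.symm
      exact ⟨⟨x', ⟨z, hz, hzx'⟩, hx'⟩, y, hy, hyx⟩
    · rintro ⟨⟨x', ⟨z, hz, hzx'⟩, hx'⟩, y, hy, hyx⟩
      exact ⟨y, ⟨⟨z, hz, φ.preserves_equiv _ _ _ _ hzx' hyx hx'⟩, hy⟩, hyx⟩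

end koMap

/-- The functor `G` from the opposite of the category of Hausdorff étale spaces to
difference-restriction algebras. -/
def G : HausEt.{u}ᵒᵖ ⥤ DRA.{u} where
  obj E := koObj E.unop
  map φ := koMap φ.unop
  map_id _ := DRA.Hom.ext (funext fun U => Subtype.ext (preimage_id U.1))
  map_comp φ ψ := DRA.Hom.ext (funext fun U => Subtype.ext
    (PFun.preimage_comp (HausEt.Hom.toPFun φ.unop) (HausEt.Hom.toPFun ψ.unop) U.1))

/-! ## Algebras with operators -/

/-- Two elements of a difference-restriction algebra are compatible. -/
def Compatible {A : DRA.{u}} (a b : A) : Prop := rest a b = rest b a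

/-- Compatibility preserving operations. -/
def CompatibilityPreserving {A : DRA.{u}} {n : ℕ} (Ω : (Fin n → A) → A) : Prop :=
  ∀ a a' : Fin n → A, (∀ i, Compatible (a i) (a' i)) → Compatible (Ω a) (Ω a')

/-- Normal operations. -/
def Normal {A : DRA.{u}} {n : ℕ} (Ω : (Fin n → A) → A) : Prop :=
  ∀ (a : Fin n → A) (i : Fin n), Ω (Function.update a i ⊥) = ⊥

/-- Additive operations: existing binary joins are sent to joins, in each argument. -/
def Additive {A : DRA.{u}} {n : ℕ} (Ω : (Fin n → A) → A) : Prop :=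
  ∀ (a : Fin n → A) (i : Fin n) (b c d : A), IsLUB {b, c} d →
    IsLUB {Ω (Function.update a i b), Ω (Function.update a i c)} (Ω (Function.update a i d))

/-- Compatibility preserving operators. -/
structure IsCompatibleOperator {A : DRA.{u}} {n : ℕ} (Ω : (Fin n → A) → A) : Prop where
  compatibilityPreserving : CompatibilityPreserving Ω
  normal : Normal Ω
  additive : Additive Ω

variable {σ : Type v}

/-- Objects of `DRA(σ)`, where `ar` gives the arities of the symbols of the signature `σ`. -/
structure DRAOp (ar : σ → ℕ) : Type (max (u + 1) v) where
  toDRA : DRA.{u}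
  op : ∀ s, (Fin (ar s) → toDRA) → toDRA
  isCompatibleOperator : ∀ s, IsCompatibleOperator (op s)

/-- Homomorphisms of difference-restriction algebras that preserve the operators. -/
@[ext] structure DRAOp.Hom {ar : σ → ℕ} (A B : DRAOp.{u} ar) where
  toHom : A.toDRA ⟶ B.toDRA
  map_op : ∀ s (a : Fin (ar s) → A.toDRA),
    toHom.toFun (A.op s a) = B.op s (fun i => toHom.toFun (a i))

/-- The category `DRA(σ)`. -/
instance (ar : σ → ℕ) : Category (DRAOp.{u} ar) where
  Hom A B := DRAOp.Hom A B
  id A := ⟨𝟙 A.toDRA, fun _ _ => rfl⟩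
  comp f g := ⟨f.toHom ≫ g.toHom, fun s a =>
    (congrArg g.toHom.toFun (f.map_op s a)).trans (g.map_op s _)⟩

/-- The `{-, rest}`-reduct. -/
def DRAOp.reduct (ar : σ → ℕ) : DRAOp.{u} ar ⥤ DRA.{u} where
  obj A := A.toDRA
  map f := f.toHom

/-! ## Spaces with relations -/

/-- The operation on subsets induced by an `(n+1)`-ary relation. -/
def relOp {X : Type u} {n : ℕ} (R : (Fin n → X) → X → Prop) (S : Fin n → Set X) : Set X :=
  {y | ∃ x : Fin n → X, (∀ i, x i ∈ S i) ∧ R x y}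

/-- Continuous relations. -/
def ContinuousRel {X : Type u} [TopologicalSpace X] {n : ℕ} (R : (Fin n → X) → X → Prop) : Prop :=
  ∀ S : Fin n → Set X, (∀ i, IsOpen (S i)) → IsOpen (relOp R S)

/-- Spectral relations. -/
def SpectralRel {X : Type u} [TopologicalSpace X] {n : ℕ} (R : (Fin n → X) → X → Prop) : Prop :=
  ContinuousRel R ∧ ∀ S : Fin n → Set X, (∀ i, IsCompact (S i) ∧ IsOpen (S i)) →
    IsCompact (relOp R S) ∧ IsOpen (relOp R S)

/-- Tight relations. -/
def TightRel {X : Type u} [TopologicalSpace X] {n : ℕ} (R : (Fin n → X) → X → Prop) : Prop :=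
  ∀ (x : Fin n → X) (y : X),
    (∀ S : Fin n → Set X, (∀ i, IsCompact (S i) ∧ IsOpen (S i)) → (∀ i, x i ∈ S i) →
      y ∈ relOp R S) → R x y

/-- The compatibility relation of an étale space. -/
def HausEt.Compat (E : HausEt.{u}) (x y : E.X) : Prop := E.π x = E.π y → x = y

/-- The compatibility property of a relation on an étale space. -/
def HausEt.CompatibilityProperty (E : HausEt.{u}) {n : ℕ} (R : (Fin n → E.X) → E.X → Prop) :
    Prop :=
  ∀ (x x' : Fin n → E.X) (y y' : E.X), (∀ i, E.Compat (x i) (x' i)) → R x y → R x' y' →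
    E.Compat y y'

/-- Tight spectral relations with the compatibility property. -/
structure HausEt.IsAdmissible (E : HausEt.{u}) {n : ℕ} (R : (Fin n → E.X) → E.X → Prop) :
    Prop where
  tight : TightRel R
  spectral : SpectralRel R
  compatibilityProperty : E.CompatibilityProperty R

/-- The reverse forth condition. -/
def ReverseForth {X Y : Type u} (φ : X →. Y) {n : ℕ} (RX : (Fin n → X) → X → Prop)
    (RY : (Fin n → Y) → Y → Prop) : Prop :=
  ∀ (x : Fin n → X) (x' : X) (y : Fin n → Y), RX x x' → (∀ i, y i ∈ φ (x i)) →
    ∃ y' ∈ φ x', RY y y'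

/-- The back condition. -/
def Back {X Y : Type u} (φ : X →. Y) {n : ℕ} (RX : (Fin n → X) → X → Prop)
    (RY : (Fin n → Y) → Y → Prop) : Prop :=
  ∀ (x' : X) (y : Fin n → Y) (y' : Y), y' ∈ φ x' → RY y y' →
    ∃ x : Fin n → X, (∀ i, y i ∈ φ (x i)) ∧ RX x x'

/-- Objects of `HausEt(σ)`. -/
structure HausEtRel (ar : σ → ℕ) : Type (max (u + 1) v) where
  toHausEt : HausEt.{u}
  rel : ∀ s, (Fin (ar s) → toHausEt.X) → toHausEt.X → Prop
  isAdmissible : ∀ s, toHausEt.IsAdmissible (rel s)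

/-- Morphisms of Hausdorff étale spaces satisfying the reverse forth and back conditions. -/
@[ext] structure HausEtRel.Hom {ar : σ → ℕ} (E D : HausEtRel.{u} ar) where
  toHom : E.toHausEt ⟶ D.toHausEt
  reverseForth : ∀ s, ReverseForth toHom.toPFun (E.rel s) (D.rel s)
  back : ∀ s, Back toHom.toPFun (E.rel s) (D.rel s)

/-- The category `HausEt(σ)`. -/
instance (ar : σ → ℕ) : Category (HausEtRel.{u} ar) where
  Hom E D := HausEtRel.Hom E D
  id E :=
    { toHom := 𝟙 E.toHausEt
      reverseForth := fun s x x' y hR hy => by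
        have : y = x := funext fun i => Part.mem_some_iff.mp (hy i)
        exact ⟨x', Part.mem_some x', this ▸ hR⟩
      back := fun s x' y y' hy' hR => by
        have : y' = x' := Part.mem_some_iff.mp hy'
        exact ⟨y, fun i => Part.mem_some (y i), this ▸ hR⟩ }
  comp {E D C} f g :=
    { toHom := f.toHom ≫ g.toHom
      reverseForth := fun s x x' z hR hz => by
        have hz' : ∀ i, ∃ y ∈ f.toHom.toPFun (x i), z i ∈ g.toHom.toPFun y := fun i =>
          Part.mem_bind_iff.mp (hz i)
        choose y hy hyz using hz'
        obtain ⟨y', hy', hR'⟩ := f.reverseForth s x x' y hR hy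
        obtain ⟨z', hz', hR''⟩ := g.reverseForth s y y' z hR' hyz
        exact ⟨z', Part.mem_bind_iff.mpr ⟨y', hy', hz'⟩, hR''⟩
      back := fun s x' z z' hz' hR => by
        obtain ⟨y', hy', hyz'⟩ := Part.mem_bind_iff.mp hz'
        obtain ⟨y, hyz, hR'⟩ := g.back s y' z z' hyz' hR
        obtain ⟨x, hxy, hR''⟩ := f.back s x' y y' hy' hR'
        exact ⟨x, fun i => Part.mem_bind_iff.mpr ⟨y i, hxy i, hyz i⟩, hR''⟩ }
  id_comp f := HausEtRel.Hom.ext (Category.id_comp f.toHom)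
  comp_id f := HausEtRel.Hom.ext (Category.comp_id f.toHom)
  assoc f g h := HausEtRel.Hom.ext (Category.assoc f.toHom g.toHom h.toHom)

/-- The underlying Hausdorff étale space. -/
def HausEtRel.reduct (ar : σ → ℕ) : HausEtRel.{u} ar ⥤ HausEt.{u} where
  obj E := E.toHausEt
  map f := f.toHom

/-! ## Relations from operations and operations from relations -/

/-- The relation on maximal filters obtained from an operation. -/
def opRel {A : DRA.{u}} {n : ℕ} (Ω : (Fin n → A) → A) (μ : Fin n → MaxFilter A)
    (ν : MaxFilter A) : Prop :=
  ∀ a : Fin n → A, (∀ i, a i ∈ μ i) → Ω a ∈ ν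

/-- The operation on the dual algebra obtained from a spectral relation with the compatibility
property. -/
def koOp (E : HausEt.{u}) {n : ℕ} (R : (Fin n → E.X) → E.X → Prop) (hR : E.IsAdmissible R)
    (S : Fin n → koObj E) : koObj E :=
  ⟨relOp R (fun i => (S i).1),
    (hR.spectral.2 _ fun i => ⟨(S i).2.1, (S i).2.2.1⟩).1,
    (hR.spectral.2 _ fun i => ⟨(S i).2.1, (S i).2.2.1⟩).2,
    fun y ⟨x, hx, hxy⟩ y' ⟨x', hx', hxy'⟩ =>
      hR.compatibilityProperty x x' y y' (fun i => (S i).2.2.2 (hx i) (hx' i)) hxy hxy'⟩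

/-- The assignment sending an algebra with operators to its Hausdorff étale space with the
relations obtained from the operators, and a homomorphism `h` to `F h`, is well defined. -/
structure FLifts (ar : σ → ℕ) : Prop where
  obj : ∀ (A : DRAOp.{u} ar) (s : σ), (specObj A.toDRA).IsAdmissible (opRel (A.op s))
  map : ∀ (A B : DRAOp.{u} ar) (h : A ⟶ B) (s : σ),
    ReverseForth (specMap h.toHom).toPFun (opRel (B.op s)) (opRel (A.op s)) ∧
    Back (specMap h.toHom).toPFun (opRel (B.op s)) (opRel (A.op s))

/-- The assignment sending a Hausdorff étale space with relations to its algebra of compact open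
sets with the operations obtained from the relations, and a morphism `φ` to `G φ`, is well
defined. -/
structure GLifts (ar : σ → ℕ) : Prop where
  obj : ∀ (E : HausEtRel.{u} ar) (s : σ),
    IsCompatibleOperator (koOp E.toHausEt (E.rel s) (E.isAdmissible s))
  map : ∀ (E D : HausEtRel.{u} ar) (φ : E ⟶ D) (s : σ) (S : Fin (ar s) → koObj D.toHausEt),
    (koMap φ.toHom).toFun (koOp D.toHausEt (D.rel s) (D.isAdmissible s) S) =
      koOp E.toHausEt (E.rel s) (E.isAdmissible s) (fun i => (koMap φ.toHom).toFun (S i))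

/-- The object part of the lifted functor on algebras. -/
def liftFObj {ar : σ → ℕ} (w : FLifts.{u} ar) (A : DRAOp.{u} ar) : HausEtRel.{u} ar where
  toHausEt := specObj A.toDRA
  rel s := opRel (A.op s)
  isAdmissible := w.obj A

/-- The functor from `DRA(σ)` to the opposite of `HausEt(σ)`: `F`, with the relations obtained
from the operators. -/
def liftF {ar : σ → ℕ} (w : FLifts.{u} ar) : DRAOp.{u} ar ⥤ (HausEtRel.{u} ar)ᵒᵖ where
  obj A := op (liftFObj w A)
  map {A B} h := Quiver.Hom.op (X := liftFObj w B) (Y := liftFObj w A)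
    ⟨specMap h.toHom, fun s => (w.map A B h s).1, fun s => (w.map A B h s).2⟩
  map_id A := by
    apply Quiver.Hom.unop_inj
    exact HausEtRel.Hom.ext (congrArg Quiver.Hom.unop (F.map_id A.toDRA))
  map_comp f g := by
    apply Quiver.Hom.unop_inj
    exact HausEtRel.Hom.ext (congrArg Quiver.Hom.unop (F.map_comp f.toHom g.toHom))

/-- The object part of the lifted functor on spaces. -/
def liftGObj {ar : σ → ℕ} (w : GLifts.{u} ar) (E : HausEtRel.{u} ar) : DRAOp.{u} ar where
  toDRA := koObj E.toHausEt
  op s := koOp E.toHausEt (E.rel s) (E.isAdmissible s)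
  isCompatibleOperator := w.obj E

/-- The functor from the opposite of `HausEt(σ)` to `DRA(σ)`: `G`, with the operations obtained
from the relations. -/
def liftG {ar : σ → ℕ} (w : GLifts.{u} ar) : (HausEtRel.{u} ar)ᵒᵖ ⥤ DRAOp.{u} ar where
  obj E := liftGObj w E.unop
  map {E D} φ := ⟨koMap φ.unop.toHom, w.map D.unop E.unop φ.unop⟩
  map_id E := DRAOp.Hom.ext (G.map_id (op E.unop.toHausEt))
  map_comp f g := DRAOp.Hom.ext (G.map_comp f.unop.toHom.op g.unop.toHom.op)

end DiffRest

namespace DiffRest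

/-! ### Primeness of maximal filters, and the extension lemma for operators -/

section operators
variable {A : DRA.{u}}

/-! The lifted functors have the same underlying spaces, algebras and maps as `F` and `G`.
Naturality and the triangle identities are equations between underlying maps, so they pass from `F ⊣
G` to the lift. What must be proved is that the extra structure is respected: by the relations
`opRel`, by the operations `koOp`, by the images of morphisms, and by the unit and counit.

The main tool on the algebra side is `exists_opRel_of_isFilter`, an analogue of the Jónsson–Tarski
prime filter argument. If an operator sends a tuple of filters into a maximal filter `ν`, Zorn's
lemma enlarges it to a maximal such tuple; normality makes its components proper, and additivity
with the primeness of `ν` makes them prime. Applied to principal filters it gives `relOp_opRel_hat`: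
on basic sets `hat a` the relation computes the operator. Tightness, spectrality and preservation of
the operators by the unit all follow from this identity. Applied to filters generated by the image
of a homomorphism it gives the back condition.

On the space side, existing joins are unions and compatibility is pointwise, so the operator laws
are properties of direct images under a relation. The back and reverse forth conditions give the two
inclusions in `gLifts`. For the counit, compactness makes every maximal filter of compact opens the
filter of a point (`exists_mem_pointPFun_of_maxFilter`), and tightness recovers the relation from
its action on compact opens (`back_pointPFun`). -/

theorem MaxFilter.eq_of_subset {μ ν : MaxFilter A} (h : ∀ a, a ∈ μ → a ∈ ν) : μ = ν :=
  Subtype.ext (Set.Subset.antisymm h (μ.2.le_of_ge ν.2.prop h))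

theorem sub_le_self (a b : A) : a - b ≤ a := by
  obtain ⟨X, Y, r, hi, hp, hd, hr, hle, hm, h0⟩ := exists_rep A
  rw [hle]
  intro x y
  rw [hd]
  exact fun h => h.1

theorem rest_le_right (a b : A) : rest a b ≤ b := by
  obtain ⟨X, Y, r, hi, hp, hd, hr, hle, hm, h0⟩ := exists_rep A
  rw [hle]
  intro x y
  rw [hr]
  exact fun h => h.2

theorem rest_eq_bot_symm {a b : A} (h : rest a b = ⊥) : rest b a = ⊥ := by
  have h' := h.le
  rw [← le_bot_iff]
  obtain ⟨X, Y, r, hi, hp, hd, hr, hle, hm, h0⟩ := exists_rep A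
  rw [hle] at h' ⊢
  intro x y
  simp only [hr] at h' ⊢
  rintro ⟨⟨z, hz⟩, hy⟩
  exact absurd (h' x z ⟨⟨y, hy⟩, hz⟩) (h0 _ _)

theorem inf_sub_le (a b : A) : a ⊓ (b - a) ≤ ⊥ := by
  obtain ⟨X, Y, r, hi, hp, hd, hr, hle, hm, h0⟩ := exists_rep A
  rw [hle]
  intro x y
  rw [hm, hd]
  tauto

/-- The join to which additivity is applied when maximal tuples of filters are shown to be prime. -/
theorem isLUB_inf_sub (a b : A) : IsLUB {a ⊓ b, a - b} a := by
  constructor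
  · rintro c (rfl | rfl)
    · exact inf_le_left
    · exact sub_le_self a b
  · intro c hc
    have h1 : a ⊓ b ≤ c := hc (Set.mem_insert _ _)
    have h2 : a - b ≤ c := hc (Set.mem_insert_of_mem _ rfl)
    obtain ⟨X, Y, r, hi, hp, hd, hr, hle, hm, h0⟩ := exists_rep A
    rw [hle] at h1 h2 ⊢
    intro x y h
    have h1 := h1 x y
    have h2 := h2 x y
    rw [hm] at h1
    rw [hd] at h2
    tauto

/-- Through this trivial join, additivity yields monotonicity. -/
theorem isLUB_pair_of_le {a b : A} (h : a ≤ b) : IsLUB {a, b} b := by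
  constructor
  · rintro c (rfl | rfl)
    · exact h
    · exact le_rfl
  · exact fun c hc => hc (Set.mem_insert_of_mem _ rfl)

/-- Maximal filters are prime with respect to the existing binary joins. -/
theorem MaxFilter.mem_or_mem_of_isLUB (μ : MaxFilter A) {a b c : A} (h : IsLUB {a, b} c)
    (hc : c ∈ μ) : a ∈ μ ∨ b ∈ μ := by
  rcases μ.prime hc a with h1 | h1
  · exact Or.inl (μ.mem_of_le h1 inf_le_right)
  rcases μ.prime h1 b with h2 | h2
  · exact Or.inr (μ.mem_of_le h2 inf_le_right)
  exfalso
  have ha : a ≤ c := h.1 (Set.mem_insert _ _)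
  have hb : b ≤ c := h.1 (Set.mem_insert_of_mem _ rfl)
  -- The right side is an upper bound of `a` and `b`, hence lies above their join `c`. So `μ` would
  -- contain this element together with `c - a - b`, which is disjoint from it.
  have hup : c ≤ c - (c - a - b) := by
    apply h.2
    rintro d (rfl | rfl)
    all_goals
      obtain ⟨X, Y, r, hi, hp, hd, hr, hle, hm, h0⟩ := exists_rep A
      rw [hle] at *
      intro x y
      simp only [hd]
      grind
  refine μ.bot_not_mem (μ.mem_of_le (μ.inf_mem h2 (μ.mem_of_le hc hup)) ?_)
  exact inf_sub_le _ _

theorem hat_sub (a b : A) : hat (a - b) = hat a \ hat b := by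
  ext μ
  constructor
  · intro h
    exact ⟨μ.mem_of_le h (sub_le_self a b), fun h' =>
      μ.bot_not_mem (μ.mem_of_le (μ.inf_mem h' h) (inf_sub_le b a))⟩
  · rintro ⟨ha, hb⟩
    exact (μ.prime ha b).resolve_left fun h => hb (μ.mem_of_le h inf_le_right)

/-- The left-to-right inclusion needs a maximal filter equivalent to `ν` and containing `a`;
`exists_equiv_mem` supplies it. -/
theorem hat_rest (a b : A) : hat (rest a b) = specMk ⁻¹' (specMk '' hat a) ∩ hat b := by
  ext ν
  constructor
  · intro h
    obtain ⟨μ, hμ, ha⟩ := exists_equiv_mem ν a b h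
    exact ⟨⟨μ, ha, (specMk_eq.mpr hμ).symm⟩, ν.mem_of_le h (rest_le_right a b)⟩
  · rintro ⟨⟨μ, ha, hμ⟩, hb⟩
    exact specMk_eq.mp hμ a ha b hb

theorem injOn_specMk_hat (a : A) : Set.InjOn specMk (hat a) :=
  fun _ hμ _ hν h => (specMk_eq.mp h).eq_of_mem hμ hν

variable {n : ℕ} {Ω : (Fin n → A) → A}

theorem Additive.update_le (h : Additive Ω) (a : Fin n → A) (i : Fin n) {b c : A} (hbc : b ≤ c) :
    Ω (Function.update a i b) ≤ Ω (Function.update a i c) :=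
  (h a i b c c (isLUB_pair_of_le hbc)).1 (Set.mem_insert _ _)

/-- Additivity concerns one argument at a time, so the coordinates of `a` are replaced by those of
`b` one by one. -/
theorem Additive.mono (h : Additive Ω) {a b : Fin n → A} (hab : ∀ i, a i ≤ b i) :
    Ω a ≤ Ω b := by
  have key : ∀ s : Finset (Fin n), Ω a ≤ Ω (s.piecewise b a) := by
    intro s
    induction s using Finset.induction_on with
    | empty => rw [Finset.piecewise_empty]
    | insert j s hj ih =>
      refine ih.trans ?_
      rw [Finset.piecewise_insert]
      -- Since `j ∉ s`, the tuple still has the value `a j` at `j`.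
      have : s.piecewise b a = Function.update (s.piecewise b a) j (a j) := by
        rw [← Finset.piecewise_eq_of_notMem s b a hj, Function.update_eq_self]
      conv_lhs => rw [this]
      exact h.update_le _ j (hab j)
  have := key Finset.univ
  rwa [Finset.piecewise_univ] at this

/-- This is the filter generated by `F` and `c`. It may be improper, which is harmless: the Zorn
argument ranges over all filters. -/
theorem isFilter_adjoin {F : Set A} (hF : IsFilter F) (c : A) :
    IsFilter {d | ∃ m ∈ F, m ⊓ c ≤ d} := by
  obtain ⟨m₀, hm₀⟩ := hF.1
  refine ⟨⟨m₀ ⊓ c, m₀, hm₀, le_rfl⟩, fun d e ⟨m, hm, h⟩ hde => ⟨m, hm, h.trans hde⟩, ?_⟩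
  rintro d e ⟨m, hm, h⟩ ⟨m', hm', h'⟩
  exact ⟨m ⊓ m', hF.2.2 _ _ hm hm', le_inf ((inf_le_inf_right c inf_le_left).trans h)
    ((inf_le_inf_right c inf_le_right).trans h')⟩

/-- A tuple of filters that an operator maps into a maximal filter extends to a tuple of maximal
filters with this property. -/
theorem exists_opRel_of_isFilter (hn : Normal Ω) (ha : Additive Ω) (F : Fin n → Set A)
    (hF : ∀ i, IsFilter (F i)) (ν : MaxFilter A) (hν : ∀ a, (∀ i, a i ∈ F i) → Ω a ∈ ν) :
    ∃ μ : Fin n → MaxFilter A, (∀ i, ∀ a ∈ F i, a ∈ μ i) ∧ opRel Ω μ ν := by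
  -- Maximality is taken over whole tuples, ordered coordinatewise, rather than one coordinate after
  -- another.
  obtain ⟨M, hFM, hM⟩ := zorn_le_nonempty₀
    {G : Fin n → Set A | (∀ i, IsFilter (G i)) ∧ ∀ a, (∀ i, a i ∈ G i) → Ω a ∈ ν} (by
      intro c hcS hc G₀ hG₀
      have hdir : ∀ G ∈ c, ∀ G' ∈ c, ∃ G'' ∈ c, G ≤ G'' ∧ G' ≤ G'' := hc.directedOn
      refine ⟨fun i => {x | ∃ G ∈ c, x ∈ G i}, ⟨fun i => ⟨?_, ?_, ?_⟩, ?_⟩, ?_⟩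
      · obtain ⟨x, hx⟩ := ((hcS hG₀).1 i).1
        exact ⟨x, G₀, hG₀, hx⟩
      · rintro a b ⟨G, hG, haG⟩ hab
        exact ⟨G, hG, ((hcS hG).1 i).2.1 a b haG hab⟩
      · rintro a b ⟨G, hG, haG⟩ ⟨G', hG', hbG'⟩
        obtain ⟨G'', hG'', h1, h2⟩ := hdir G hG G' hG'
        exact ⟨G'', hG'', ((hcS hG'').1 i).2.2 a b (h1 i haG) (h2 i hbG')⟩
      · intro a ha
        choose G hG haG using ha
        -- As there are finitely many coordinates, one member of the chain contains all the `a i`.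
        -- The member `G₀` serves for the empty set of coordinates, which covers arity zero.
        have hfin : ∀ s : Finset (Fin n), ∃ G' ∈ c, ∀ i ∈ s, G i ≤ G' := by
          intro s
          induction s using Finset.induction_on with
          | empty => exact ⟨G₀, hG₀, by simp⟩
          | insert j s _ ih =>
            obtain ⟨G', hG', h⟩ := ih
            obtain ⟨G'', hG'', h1, h2⟩ := hdir (G j) (hG j) G' hG'
            refine ⟨G'', hG'', fun i hi => ?_⟩
            rcases Finset.mem_insert.mp hi with rfl | hi
            · exact h1
            · exact (h i hi).trans h2
        obtain ⟨G', hG', h⟩ := hfin Finset.univ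
        exact (hcS hG').2 a fun i => h i (Finset.mem_univ i) i (haG i)
      · exact fun G hG i x hx => ⟨G, hG, hx⟩) F ⟨hF, hν⟩
  have hMf := hM.prop.1
  have hMν := hM.prop.2
  have hupd : ∀ (x : Fin n → A) (i : Fin n) (b : A), (∀ j, x j ∈ M j) → b ∈ M i →
      ∀ j, Function.update x i b j ∈ M j := by
    intro x i b hx hb j
    rcases eq_or_ne j i with rfl | hj
    · rwa [Function.update_self]
    · rw [Function.update_of_ne hj]
      exact hx j
  -- Under this hypothesis, adjoining `c` to the component `M i` keeps the tuple admissible, so by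
  -- maximality `c` is already there.
  have hext : ∀ i c, (∀ x : Fin n → A, (∀ j, x j ∈ M j) →
      Ω (Function.update x i (x i ⊓ c)) ∈ ν) → c ∈ M i := by
    intro i c hc
    let N : Fin n → Set A := Function.update M i {d | ∃ m ∈ M i, m ⊓ c ≤ d}
    have hNi : N i = {d | ∃ m ∈ M i, m ⊓ c ≤ d} := Function.update_self ..
    have hNj : ∀ j, j ≠ i → N j = M j := fun j hj => Function.update_of_ne hj ..
    have hMN : M ≤ N := by
      intro j x hx
      rcases eq_or_ne j i with rfl | hj
      · rw [hNi]
        exact ⟨x, hx, inf_le_left⟩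
      · rwa [hNj j hj]
    have hN : N ≤ M := by
      refine hM.le_of_ge ⟨fun j => ?_, fun a haN => ?_⟩ hMN
      · rcases eq_or_ne j i with rfl | hj
        · rw [hNi]
          exact isFilter_adjoin (hMf j) c
        · rw [hNj j hj]
          exact hMf j
      · have hai := haN i
        rw [hNi] at hai
        obtain ⟨m, hm, hma⟩ := hai
        have hx : ∀ j, Function.update a i m j ∈ M j := by
          intro j
          rcases eq_or_ne j i with rfl | hj
          · rwa [Function.update_self]
          · rw [Function.update_of_ne hj, ← hNj j hj]
            exact haN j
        have h1 := hc _ hx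
        rw [Function.update_self, Function.update_idem] at h1
        refine ν.mem_of_le h1 ?_
        conv_rhs => rw [← Function.update_eq_self i a]
        exact ha.update_le a i hma
    obtain ⟨m, hm⟩ := (hMf i).1
    apply hN i
    rw [hNi]
    exact ⟨m, hm, inf_le_right⟩
  have hmax : ∀ i, IsMaximalFilter (M i) := by
    intro i
    refine isMaximalFilter_of_prime (hMf i) ?_ ?_
    · intro h0
      choose x hx using fun j => (hMf j).1
      have := hMν _ (hupd x i ⊥ hx h0)
      rw [hn] at this
      exact ν.bot_not_mem this
    · intro a haM b
      by_contra! hcon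
      obtain ⟨h1, h2⟩ := hcon
      have h1 := mt (hext i _) h1
      have h2 := mt (hext i _) h2
      push Not at h1 h2
      obtain ⟨x, hx, hxν⟩ := h1
      obtain ⟨y, hy, hyν⟩ := h2
      have hz : ∀ j, x j ⊓ y j ∈ M j := fun j => (hMf j).2.2 _ _ (hx j) (hy j)
      -- The tuples `x` and `y` witness that neither `a ⊓ b` nor `a - b` can be adjoined. The
      -- operator sends their meet, cut down by `a` at `i`, into `ν`; splitting the `i`-th entry
      -- along `b` puts one of two smaller values in `ν`, and monotonicity contradicts one of the
      -- witnesses.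
      have hw := hMν _ (hupd (fun j => x j ⊓ y j) i (x i ⊓ y i ⊓ a) hz
        ((hMf i).2.2 _ _ (hz i) haM))
      rcases ν.mem_or_mem_of_isLUB (ha (fun j => x j ⊓ y j) i _ _ _ (isLUB_inf_sub _ b)) hw with
        h | h
      · refine hxν (ν.mem_of_le h (ha.mono fun j => ?_))
        rcases eq_or_ne j i with rfl | hj
        · rw [Function.update_self, Function.update_self, inf_assoc, inf_assoc]
          exact inf_le_inf_left _ inf_le_right
        · rw [Function.update_of_ne hj, Function.update_of_ne hj]
          exact inf_le_left
      · refine hyν (ν.mem_of_le h (ha.mono fun j => ?_))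
        rcases eq_or_ne j i with rfl | hj
        · rw [Function.update_self, Function.update_self]
          obtain ⟨X, Y, r, hi, hp, hd, hr, hle, hm, h0⟩ := exists_rep A
          rw [hle]
          intro s t
          simp only [hm, hd]
          tauto
        · rw [Function.update_of_ne hj, Function.update_of_ne hj]
          exact inf_le_right
  exact ⟨fun i => ⟨M i, hmax i⟩, fun i a h => hFM i h, hMν⟩

theorem isFilter_Ici (a : A) : IsFilter (Set.Ici a) :=
  ⟨⟨a, Set.mem_Ici.mpr le_rfl⟩, fun _ _ h h' => Set.mem_Ici.mpr ((Set.mem_Ici.mp h).trans h'),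
    fun _ _ h h' => Set.mem_Ici.mpr (le_inf (Set.mem_Ici.mp h) (Set.mem_Ici.mp h'))⟩

/-- If `Ω a ∈ ν`, then by monotonicity `Ω` maps the principal filters of the `a i` into `ν`, and
these extend to related maximal filters. -/
theorem relOp_opRel_hat (hΩ : IsCompatibleOperator Ω) (a : Fin n → A) :
    relOp (opRel Ω) (fun i => hat (a i)) = hat (Ω a) := by
  ext ν
  constructor
  · rintro ⟨μ, hμ, h⟩
    exact h a hμ
  · intro h
    obtain ⟨μ, hμ, hR⟩ := exists_opRel_of_isFilter hΩ.normal hΩ.additive (fun i => Set.Ici (a i))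
      (fun i => isFilter_Ici _) ν fun b hb => ν.mem_of_le h (hΩ.additive.mono hb)
    exact ⟨μ, fun i => hμ i _ (Set.mem_Ici.mpr le_rfl), hR⟩

end operators

/-! ### Direct images under a relation -/

section relOp
variable {X : Type u} {n : ℕ} (R : (Fin n → X) → X → Prop)

theorem relOp_mono {S T : Fin n → Set X} (h : ∀ i, S i ⊆ T i) : relOp R S ⊆ relOp R T :=
  fun _ ⟨x, hx, hR⟩ => ⟨x, fun i => h i (hx i), hR⟩

/-- Existential quantifiers commute with unions: `f` picks an index for each coordinate. This
reduces spectrality to basic sets. -/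
theorem relOp_biUnion {ι : Type*} (J : Fin n → Set ι) (S : ι → Set X) :
    relOp R (fun i => ⋃ j ∈ J i, S j) =
      ⋃ f ∈ Set.univ.pi J, relOp R (fun i => S (f i)) := by
  ext y
  simp only [relOp, Set.mem_iUnion, Set.mem_ofPred_eq, Set.mem_univ_pi, exists_prop]
  constructor
  · rintro ⟨x, hx, hR⟩
    choose f hf hxf using hx
    exact ⟨f, hf, x, hxf, hR⟩
  · rintro ⟨f, hf, x, hx, hR⟩
    exact ⟨x, fun i => ⟨f i, hf i, hx i⟩, hR⟩

end relOp

/-! ### The relation of an operator is admissible -/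

section spectral
variable {A : DRA.{u}} {n : ℕ} {Ω : (Fin n → A) → A}

theorem eq_biUnion_hat {S : Set (MaxFilter A)} (hS : IsOpen S) :
    S = ⋃ a ∈ {a : A | hat a ⊆ S}, hat a := by
  apply Set.Subset.antisymm
  · intro μ hμ
    obtain ⟨_, ⟨a, rfl⟩, ha, haS⟩ := (isBasis_hat A).exists_subset_of_mem_open hμ hS
    exact Set.mem_biUnion (show a ∈ {a : A | hat a ⊆ S} from haS) ha
  · exact Set.iUnion₂_subset fun a ha => ha

theorem exists_eq_biUnion_hat {S : Set (MaxFilter A)} (hS : IsCompact S ∧ IsOpen S) :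
    ∃ t : Set A, t.Finite ∧ S = ⋃ a ∈ t, hat a := by
  obtain ⟨t, htS, ht, hSt⟩ := hS.1.elim_finite_subcover_image (fun a _ => isOpen_hat a)
    (eq_biUnion_hat hS.2).subset
  exact ⟨t, ht, hSt.antisymm (Set.iUnion₂_subset fun a ha => htS ha)⟩

theorem isOpen_relOp_opRel (hΩ : IsCompatibleOperator Ω) {S : Fin n → Set (MaxFilter A)}
    (hS : ∀ i, IsOpen (S i)) : IsOpen (relOp (opRel Ω) S) := by
  have : S = fun i => ⋃ a ∈ {a : A | hat a ⊆ S i}, hat a := funext fun i => eq_biUnion_hat (hS i)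
  rw [this, relOp_biUnion]
  refine isOpen_biUnion fun f _ => ?_
  rw [relOp_opRel_hat hΩ]
  exact isOpen_hat _

theorem isCompact_relOp_opRel (hΩ : IsCompatibleOperator Ω) {S : Fin n → Set (MaxFilter A)}
    (hS : ∀ i, IsCompact (S i) ∧ IsOpen (S i)) : IsCompact (relOp (opRel Ω) S) := by
  choose t ht hSt using fun i => exists_eq_biUnion_hat (hS i)
  rw [funext hSt, relOp_biUnion]
  refine (Set.Finite.pi fun i => ht i).isCompact_biUnion fun f _ => ?_
  rw [relOp_opRel_hat hΩ]
  exact isCompact_hat _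

theorem isAdmissible_opRel (hΩ : IsCompatibleOperator Ω) :
    (specObj A).IsAdmissible (opRel Ω) where
  -- It suffices to test with the compact open sets `hat (a i)`.
  tight μ ν h a ha :=
    (relOp_opRel_hat hΩ a).subset
      (h (fun i => hat (a i)) (fun i => ⟨isCompact_hat _, isOpen_hat _⟩) ha)
  spectral := ⟨fun S hS => isOpen_relOp_opRel hΩ hS, fun S hS =>
    ⟨isCompact_relOp_opRel hΩ hS, isOpen_relOp_opRel hΩ fun i => (hS i).2⟩⟩
  compatibilityProperty := by
    intro (μ : Fin n → MaxFilter A) (μ' : Fin n → MaxFilter A) (ν : MaxFilter A)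
      (ν' : MaxFilter A) hC hR hR' hν
    have hν : FilterEquiv ν ν' := specMk_eq.mp hν
    -- Equivalent filters are equal here by `hC` and share an element; inequivalent ones contain
    -- elements with disjoint domains, both of whose restrictions are `⊥`.
    have key : ∀ i, ∃ a ∈ μ i, ∃ a' ∈ μ' i, Compatible a a' := by
      intro i
      by_cases he : FilterEquiv (μ i) (μ' i)
      · obtain ⟨a, ha⟩ := (μ i).exists_mem
        have : μ i = μ' i := hC i (specMk_eq.mpr he)
        exact ⟨a, ha, a, this ▸ ha, rfl⟩
      · obtain ⟨a, ha, a', ha', h⟩ := exists_rest_eq_bot he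
        exact ⟨a, ha, a', ha', h.trans (rest_eq_bot_symm h).symm⟩
    choose a ha a' ha' hc using key
    have h1 : Ω a ∈ ν := hR a ha
    have h2 : rest (Ω a) (Ω a') ∈ ν' := hν _ h1 _ (hR' a' ha')
    -- After the swap the restriction lies below `Ω a`, so the equivalent filters `ν` and `ν'` share
    -- `Ω a` and coincide.
    rw [hΩ.compatibilityPreserving a a' hc] at h2
    exact hν.eq_of_mem h1 (ν'.mem_of_le h2 (rest_le_right _ _))

end spectral

/-! ### Homomorphisms induce maps satisfying the reverse forth and back conditions -/

section homomorphisms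
variable {A B : DRA.{u}} (h : DRA.Hom A B) {n : ℕ} {ΩA : (Fin n → A) → A}
  {ΩB : (Fin n → B) → B}

theorem reverseForth_comapPFun (hΩ : ∀ a, h.toFun (ΩA a) = ΩB fun i => h.toFun (a i)) :
    ReverseForth (comapPFun h) (opRel ΩB) (opRel ΩA) := by
  intro ξ ξ' μ hR hμ
  have key : ∀ a : Fin n → A, (∀ i, a i ∈ μ i) → h.toFun (ΩA a) ∈ ξ' := by
    intro a ha
    rw [hΩ]
    exact hR _ fun i => ((mem_comapPFun h).mp (hμ i) _).mp (ha i)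
  -- Any such tuple shows that the inverse image of `ξ'` is nonempty, so that the partial map is
  -- defined at `ξ'`.
  choose a ha using fun i => (μ i).exists_mem
  exact ⟨⟨_, isMaximalFilter_comap h ξ' ⟨_, key a ha⟩⟩, (mem_comapPFun h).mpr fun _ => Iff.rfl,
    key⟩

theorem isFilter_map {F : Set A} (hF : IsFilter F) : IsFilter {b | ∃ a ∈ F, h.toFun a ≤ b} := by
  obtain ⟨a₀, ha₀⟩ := hF.1
  refine ⟨⟨_, a₀, ha₀, le_rfl⟩, fun b c ⟨a, ha, hab⟩ hbc => ⟨a, ha, hab.trans hbc⟩, ?_⟩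
  rintro b c ⟨a, ha, hab⟩ ⟨a', ha', hac⟩
  refine ⟨a ⊓ a', hF.2.2 _ _ ha ha', ?_⟩
  rw [map_inf]
  exact inf_le_inf hab hac

/-- The filters generated by the images of the `μ i` are mapped into `ξ'`, so they extend to related
maximal filters `ξ i`. The inverse image of `ξ i` contains `μ i`, and equals it by maximality. -/
theorem back_comapPFun (hn : Normal ΩB) (hB : Additive ΩB)
    (hΩ : ∀ a, h.toFun (ΩA a) = ΩB fun i => h.toFun (a i)) :
    Back (comapPFun h) (opRel ΩB) (opRel ΩA) := by
  intro ξ' μ μ' hμ' hR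
  obtain ⟨ξ, hξ, hRξ⟩ := exists_opRel_of_isFilter hn hB
    (fun i => {b | ∃ a ∈ (μ i).1, h.toFun a ≤ b}) (fun i => isFilter_map h (μ i).2.prop.1) ξ' (by
      intro b hb
      choose a ha hab using hb
      refine ξ'.mem_of_le ?_ (hB.mono hab)
      rw [← hΩ]
      exact ((mem_comapPFun h).mp hμ' _).mp (hR a ha))
  refine ⟨ξ, fun i => ?_, hRξ⟩
  have hsub : ∀ a ∈ μ i, h.toFun a ∈ ξ i := fun a ha => hξ i _ ⟨a, ha, le_rfl⟩
  obtain ⟨a, ha⟩ := (μ i).exists_mem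
  have : μ i = ⟨_, isMaximalFilter_comap h (ξ i) ⟨a, hsub a ha⟩⟩ := MaxFilter.eq_of_subset hsub
  rw [this]
  exact (mem_comapPFun h).mpr fun _ => Iff.rfl

end homomorphisms

theorem fLifts {σ : Type v} (ar : σ → ℕ) : FLifts.{u} ar where
  obj A s := isAdmissible_opRel (A.isCompatibleOperator s)
  map _ B h s := ⟨reverseForth_comapPFun h.toHom (h.map_op s),
    back_comapPFun h.toHom (B.isCompatibleOperator s).normal (B.isCompatibleOperator s).additive
      (h.map_op s)⟩

/-! ### Operations on compact open sets -/

section compactOpens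
variable {E D : HausEt.{u}}

theorem koObj_ext {U V : koObj E} (h : ∀ x, x ∈ U.1 ↔ x ∈ V.1) : U = V :=
  Subtype.ext (Set.ext h)

theorem koObj_sub (U V : koObj E) : (U - V).1 = U.1 \ V.1 := rfl

theorem koObj_rest (U V : koObj E) : (rest U V).1 = E.π ⁻¹' (E.π '' U.1) ∩ V.1 := rfl

theorem koObj_inf (U V : koObj E) : (U ⊓ V).1 = U.1 ∩ V.1 :=
  show U.1 \ (U.1 \ V.1) = U.1 ∩ V.1 from Set.sdiff_sdiff_right_self _ _

theorem koObj_le {U V : koObj E} : U ≤ V ↔ U.1 ⊆ V.1 := by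
  rw [← inf_eq_left, ← Set.inter_eq_left, ← koObj_inf]
  exact Subtype.ext_iff

/-- The element `⊥` is defined from an arbitrary element, so its value is found by comparison with
the empty set. -/
theorem koObj_bot : (⊥ : koObj E).1 = ∅ := by
  refine Set.subset_empty_iff.mp (koObj_le.mp (?_ : (⊥ : koObj E) ≤
    ⟨∅, isCompact_empty, isOpen_empty, Set.injOn_empty _⟩))
  exact bot_le

theorem koObj_isLUB {U V W : koObj E} : IsLUB {U, V} W ↔ W.1 = U.1 ∪ V.1 := by
  constructor
  · intro h
    have hU : U.1 ⊆ W.1 := koObj_le.mp (h.1 (Set.mem_insert _ _))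
    have hV : V.1 ⊆ W.1 := koObj_le.mp (h.1 (Set.mem_insert_of_mem _ rfl))
    have hUV := Set.union_subset hU hV
    -- The projection need not be injective on a union; here it is, because the union lies inside
    -- the upper bound `W`.
    let T : koObj E := ⟨U.1 ∪ V.1, U.2.1.union V.2.1, U.2.2.1.union V.2.2.1, W.2.2.2.mono hUV⟩
    refine Set.Subset.antisymm (koObj_le.mp (h.2 (?_ : T ∈ _))) hUV
    rintro S (rfl | rfl)
    · exact koObj_le.mpr Set.subset_union_left
    · exact koObj_le.mpr Set.subset_union_right
  · intro h
    constructor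
    · rintro S (rfl | rfl)
      · exact koObj_le.mpr (h ▸ Set.subset_union_left)
      · exact koObj_le.mpr (h ▸ Set.subset_union_right)
    · intro T hT
      rw [koObj_le, h]
      exact Set.union_subset (koObj_le.mp (hT (Set.mem_insert _ _)))
        (koObj_le.mp (hT (Set.mem_insert_of_mem _ rfl)))

theorem koObj_compatible {U V : koObj E} :
    Compatible U V ↔ ∀ x ∈ U.1, ∀ y ∈ V.1, E.Compat x y := by
  constructor
  · intro h x hx y hy hxy
    have h1 : y ∈ (rest U V).1 := ⟨⟨x, hx, hxy⟩, hy⟩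
    rw [h] at h1
    exact U.2.2.2 hx h1.2 hxy
  · intro h
    refine koObj_ext fun z => ?_
    rw [koObj_rest, koObj_rest]
    constructor
    · rintro ⟨⟨x, hx, hxz⟩, hz⟩
      have := h x hx z hz hxz
      exact ⟨⟨z, hz, rfl⟩, this ▸ hx⟩
    · rintro ⟨⟨y, hy, hyz⟩, hz⟩
      have := h z hz y hy hyz.symm
      exact ⟨⟨z, hz, rfl⟩, this ▸ hy⟩

variable {n : ℕ} {R : (Fin n → E.X) → E.X → Prop} (hR : E.IsAdmissible R)

theorem mem_koOp {S : Fin n → koObj E} {y : E.X} :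
    y ∈ (koOp E R hR S).1 ↔ ∃ x : Fin n → E.X, (∀ i, x i ∈ (S i).1) ∧ R x y := Iff.rfl

/-- Isolating the `i`-th condition turns normality and additivity of `koOp` into propositional facts
under an existential quantifier. -/
theorem mem_update_koObj {S : Fin n → koObj E} {i : Fin n} {U : koObj E} {x : Fin n → E.X} :
    (∀ j, x j ∈ (Function.update S i U j).1) ↔ x i ∈ U.1 ∧ ∀ j, j ≠ i → x j ∈ (S j).1 := by
  constructor
  · intro h
    refine ⟨?_, fun j hj => ?_⟩
    · have := h i
      rwa [Function.update_self] at this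
    · have := h j
      rwa [Function.update_of_ne hj] at this
  · rintro ⟨hi, h⟩ j
    rcases eq_or_ne j i with rfl | hj
    · rwa [Function.update_self]
    · rw [Function.update_of_ne hj]
      exact h j hj

theorem isCompatibleOperator_koOp : IsCompatibleOperator (koOp E R hR) where
  compatibilityPreserving S S' h := by
    rw [koObj_compatible]
    rintro y ⟨x, hx, hxy⟩ y' ⟨x', hx', hxy'⟩
    exact hR.compatibilityProperty x x' y y'
      (fun i => koObj_compatible.mp (h i) _ (hx i) _ (hx' i)) hxy hxy'
  normal S i := by
    refine koObj_ext fun y => ?_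
    simp only [mem_koOp, mem_update_koObj, koObj_bot, Set.mem_empty_iff_false, false_and,
      exists_false]
  additive S i U V W h := by
    rw [koObj_isLUB] at h ⊢
    ext y
    simp only [mem_koOp, mem_update_koObj, h, Set.mem_union, or_and_right, exists_or]

end compactOpens

theorem gLifts {σ : Type v} (ar : σ → ℕ) : GLifts.{u} ar where
  obj E s := isCompatibleOperator_koOp (E.isAdmissible s)
  map E D φ s S := by
    refine koObj_ext fun x => ?_
    change x ∈ φ.toHom.toPFun.preimage (relOp (D.rel s) fun i => (S i).1) ↔
      x ∈ relOp (E.rel s) fun i => φ.toHom.toPFun.preimage (S i).1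
    rw [PFun.mem_preimage]
    constructor
    -- This inclusion is the back condition; the converse is the reverse forth condition.
    · rintro ⟨y', ⟨y, hy, hR⟩, hy'⟩
      obtain ⟨z, hz, hR'⟩ := φ.back s x y y' hy' hR
      exact ⟨z, fun i => ⟨y i, hy i, hz i⟩, hR'⟩
    · rintro ⟨z, hz, hR⟩
      choose y hy hzy using fun i => (PFun.mem_preimage _ _ _).mp (hz i)
      obtain ⟨y', hy', hR'⟩ := φ.reverseForth s z x y hR hzy
      exact ⟨y', ⟨y, hy, hR'⟩, hy'⟩

/-- The homomorphism `a ↦ hat a`. -/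
def hatHom (A : DRA.{u}) : DRA.Hom A (koObj (specObj A)) where
  toFun a := ⟨hat a, isCompact_hat a, isOpen_hat a, injOn_specMk_hat a⟩
  map_diff a b := Subtype.ext (hat_sub a b)
  map_rest a b := Subtype.ext (hat_rest a b)

/-! ### The filter of compact opens at a point -/

section points
variable (E : HausEt.{u})

theorem isMaximalFilter_point {x : E.X} (hx : ∃ U : koObj E, x ∈ U.1) :
    IsMaximalFilter {U : koObj E | x ∈ U.1} := by
  refine isMaximalFilter_of_prime ⟨hx, fun U V hU hUV => koObj_le.mp hUV hU, fun U V hU hV => ?_⟩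
    (fun h => ?_) fun U hU V => ?_
  · exact (koObj_inf U V).symm.subset ⟨hU, hV⟩
  · have h' : x ∈ (⊥ : koObj E).1 := h
    rwa [koObj_bot] at h'
  · change x ∈ (U ⊓ V).1 ∨ x ∈ (U - V).1
    rw [koObj_inf, koObj_sub]
    have hU : x ∈ U.1 := hU
    by_cases hV : x ∈ V.1
    · exact Or.inl ⟨hU, hV⟩
    · exact Or.inr ⟨hU, hV⟩

/-- The partial function `x ↦ {U | x ∈ U}`, defined on those `x` for which this set is nonempty. -/
def pointPFun : E.X →. MaxFilter (koObj E) := fun x =>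
  ⟨∃ U : koObj E, x ∈ U.1, fun hx => ⟨{U | x ∈ U.1}, isMaximalFilter_point E hx⟩⟩

variable {E}

theorem mem_pointPFun {x : E.X} {μ : MaxFilter (koObj E)} :
    μ ∈ pointPFun E x ↔ ∀ U : koObj E, U ∈ μ ↔ x ∈ U.1 := by
  constructor
  · rintro ⟨hx, rfl⟩ U
    rfl
  · intro hμ
    obtain ⟨U, hU⟩ := μ.exists_mem
    exact ⟨⟨U, (hμ U).mp hU⟩, MaxFilter.ext fun U => (hμ U).symm⟩

theorem exists_mem_pointPFun {x : E.X} {U : koObj E} (hx : x ∈ U.1) :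
    ∃ μ ∈ pointPFun E x, U ∈ μ :=
  ⟨⟨_, isMaximalFilter_point E ⟨U, hx⟩⟩, mem_pointPFun.mpr fun _ => Iff.rfl, hx⟩

theorem preimage_pointPFun_hat (U : koObj E) : (pointPFun E).preimage (hat U) = U.1 := by
  ext x
  rw [PFun.mem_preimage]
  constructor
  · rintro ⟨μ, hU, hμ⟩
    exact (mem_pointPFun.mp hμ U).mp hU
  · intro hx
    obtain ⟨μ, hμ, hU⟩ := exists_mem_pointPFun hx
    exact ⟨μ, hU, hμ⟩

theorem isOpen_preimage_pointPFun {V : Set (MaxFilter (koObj E))} (hV : IsOpen V) :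
    IsOpen ((pointPFun E).preimage V) := by
  rw [isOpen_iff_forall_mem_open]
  intro x hx
  rw [PFun.mem_preimage] at hx
  obtain ⟨μ, hμV, hμ⟩ := hx
  obtain ⟨_, ⟨U, rfl⟩, hU, hUV⟩ := (isBasis_hat (koObj E)).exists_subset_of_mem_open hμV hV
  refine ⟨U.1, ?_, U.2.2.1, (mem_pointPFun.mp hμ U).mp hU⟩
  rw [← preimage_pointPFun_hat]
  exact PFun.preimage_mono _ hUV

/-- Finitely many sets `hat U` cover `K`, and the preimage is the compact union of these `U` minus
the preimage of the open complement of `K`. -/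
theorem isCompact_preimage_pointPFun {K : Set (MaxFilter (koObj E))} (hK : IsCompact K) :
    IsCompact ((pointPFun E).preimage K) := by
  obtain ⟨t, ht⟩ := hK.elim_finite_subcover (fun U : koObj E => hat U) isOpen_hat
    (fun μ _ => by obtain ⟨U, hU⟩ := μ.exists_mem; exact Set.mem_iUnion.mpr ⟨U, hU⟩)
  have hc : IsCompact (⋃ U ∈ t, U.1) := t.isCompact_biUnion fun U _ => U.2.1
  have : (pointPFun E).preimage K = (⋃ U ∈ t, U.1) \ (pointPFun E).preimage Kᶜ := by
    ext x
    simp only [PFun.mem_preimage, Set.mem_sdiff, Set.mem_iUnion]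
    constructor
    · rintro ⟨μ, hμK, hμ⟩
      refine ⟨?_, ?_⟩
      · obtain ⟨U, hUt, hU⟩ := Set.mem_iUnion₂.mp (ht hμK)
        exact ⟨U, hUt, (mem_pointPFun.mp hμ U).mp hU⟩
      · rintro ⟨ν, hν, hν'⟩
        exact hν (Part.mem_unique hμ hν' ▸ hμK)
    · rintro ⟨⟨U, _, hU⟩, hn⟩
      obtain ⟨μ, hμ, -⟩ := exists_mem_pointPFun hU
      exact ⟨μ, by_contra fun hμK => hn ⟨μ, hμK, hμ⟩, hμ⟩
  rw [this]
  exact hc.diff (isOpen_preimage_pointPFun hK.isClosed.isOpen_compl)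

theorem pointPFun_equiv {x x' : E.X} {μ μ' : MaxFilter (koObj E)} (hμ : μ ∈ pointPFun E x)
    (hμ' : μ' ∈ pointPFun E x') (h : E.π x = E.π x') : FilterEquiv μ μ' := by
  intro U hU V hV
  rw [mem_pointPFun] at hμ hμ'
  exact (hμ' _).mpr ⟨⟨x, (hμ U).mp hU, h⟩, (hμ' V).mp hV⟩

variable (E) in
/-- The morphism from a Hausdorff étale space to the space of its algebra of compact opens. -/
def pointHom : HausEt.Hom E (specObj (koObj E)) where
  toPFun := pointPFun E
  continuous _ hV := isOpen_preimage_pointPFun hV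
  proper _ hK := isCompact_preimage_pointPFun hK
  preserves_equiv _ _ _ _ hμ hμ' h := specMk_eq.mpr (pointPFun_equiv hμ hμ' h)
  fibre_injective x x' (μ : MaxFilter (koObj E)) hμ hμ' h := by
    obtain ⟨U, hU⟩ := μ.exists_mem
    exact U.2.2.2 ((mem_pointPFun.mp hμ U).mp hU) ((mem_pointPFun.mp hμ' U).mp hU) h
  fibre_surjective x (μ : MaxFilter (koObj E)) (ν : MaxFilter (koObj E)) hμ h := by
    have h : FilterEquiv μ ν := specMk_eq.mp h
    obtain ⟨U, hU⟩ := μ.exists_mem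
    obtain ⟨V, hV⟩ := ν.exists_mem
    -- The point `x` lies in `rest V U`, so its fibre meets `V` at some `x'`. The filter of `x'` is
    -- equivalent to `ν` and shares `V` with it.
    obtain ⟨⟨x', hx', hxx'⟩, -⟩ := (mem_pointPFun.mp hμ _).mp (h.symm V hV U hU)
    obtain ⟨ν', hν', hV'⟩ := exists_mem_pointPFun hx'
    have : ν' = ν := ((pointPFun_equiv hν' hμ hxx').trans h).eq_of_mem hV' hV
    exact ⟨x', hxx', this ▸ hν'⟩

/-- Every maximal filter of compact opens is the filter of a point. -/
theorem exists_mem_pointPFun_of_maxFilter (μ : MaxFilter (koObj E)) :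
    ∃ x, μ ∈ pointPFun E x := by
  obtain ⟨U₀, hU₀⟩ := μ.exists_mem
  -- The members of `μ` are nonempty, compact and closed, and directed downwards by meets. The
  -- filter of any common point contains `μ`, hence equals it.
  have hne : (⋂ U : {U : koObj E // U ∈ μ}, U.1.1).Nonempty := by
    have : Nonempty {U : koObj E // U ∈ μ} := ⟨⟨U₀, hU₀⟩⟩
    refine IsCompact.nonempty_iInter_of_directed_nonempty_isCompact_isClosed _ ?_ ?_
      (fun U => U.1.2.1) (fun U => U.1.2.1.isClosed)
    · rintro ⟨U, hU⟩ ⟨V, hV⟩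
      exact ⟨⟨U ⊓ V, μ.inf_mem hU hV⟩, koObj_le.mp inf_le_left, koObj_le.mp inf_le_right⟩
    · rintro ⟨U, hU⟩
      rw [Set.nonempty_iff_ne_empty]
      intro h
      refine μ.bot_not_mem (μ.mem_of_le hU (koObj_le.mpr ?_))
      rw [h]
      exact Set.empty_subset _
  obtain ⟨x, hx⟩ := hne
  rw [Set.mem_iInter] at hx
  have : μ = ⟨_, isMaximalFilter_point E ⟨U₀, hx ⟨U₀, hU₀⟩⟩⟩ :=
    MaxFilter.eq_of_subset fun U hU => hx ⟨U, hU⟩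
  exact ⟨x, this ▸ mem_pointPFun.mpr fun _ => Iff.rfl⟩

variable {n : ℕ} {R : (Fin n → E.X) → E.X → Prop} (hR : E.IsAdmissible R)

theorem reverseForth_pointPFun : ReverseForth (pointPFun E) R (opRel (koOp E R hR)) := by
  intro x x' μ hx hμ
  have key : ∀ U : Fin n → koObj E, (∀ i, U i ∈ μ i) → x' ∈ (koOp E R hR U).1 :=
    fun U hU => ⟨x, fun i => (mem_pointPFun.mp (hμ i) _).mp (hU i), hx⟩
  choose U hU using fun i => (μ i).exists_mem
  obtain ⟨μ', hμ', -⟩ := exists_mem_pointPFun (key U hU)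
  exact ⟨μ', hμ', fun V hV => (mem_pointPFun.mp hμ' _).mpr (key V hV)⟩

/-- The `μ i` are filters of points `x i`, and tightness shows that these points are related to
`x'`. -/
theorem back_pointPFun : Back (pointPFun E) R (opRel (koOp E R hR)) := by
  intro x' μ μ' hμ' hRμ
  choose x hx using fun i => exists_mem_pointPFun_of_maxFilter (μ i)
  refine ⟨x, hx, hR.tight x x' fun S hS hxS => ?_⟩
  choose U hU using fun i => (μ i).exists_mem
  -- Tightness tests with arbitrary compact opens, on which the projection need not be injective;
  -- intersecting with a member of `μ i` gives an element of the algebra.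
  let V : Fin n → koObj E := fun i => ⟨S i ∩ (U i).1, (hS i).1.inter (U i).2.1,
    (hS i).2.inter (U i).2.2.1, (U i).2.2.2.mono Set.inter_subset_right⟩
  have hV : ∀ i, V i ∈ μ i := fun i =>
    (mem_pointPFun.mp (hx i) _).mpr ⟨hxS i, (mem_pointPFun.mp (hx i) _).mp (hU i)⟩
  have h : x' ∈ (koOp E R hR V).1 := (mem_pointPFun.mp hμ' _).mp (hRμ V hV)
  exact relOp_mono R (fun i => Set.inter_subset_left) h

end points

/-! ### Naturality, triangle identities and the base adjunction -/

theorem pointHom_naturality {E D : HausEt.{u}} (φ : E ⟶ D) :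
    (pointHom E : E ⟶ specObj (koObj E)) ≫ (specMap (koMap φ) : specObj (koObj E) ⟶ _) =
      φ ≫ (pointHom D : D ⟶ specObj (koObj D)) := by
  refine HausEt.Hom.ext (PFun.ext fun x (μ : MaxFilter (koObj D)) => ?_)
  refine Part.mem_bind_iff.trans (Iff.trans ?_ Part.mem_bind_iff.symm)
  constructor
  · rintro ⟨ν, hν, hμ⟩
    have hν := mem_pointPFun.mp hν
    have hμ := (mem_comapPFun (koMap φ)).mp hμ
    -- Both composites send `x` to the filter of those `U` whose preimage contains `x`.
    have key : ∀ U : koObj D, U ∈ μ ↔ x ∈ φ.toPFun.preimage U.1 := fun U => (hμ U).trans (hν _)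
    obtain ⟨U, hU⟩ := μ.exists_mem
    obtain ⟨y, -, hy⟩ := (PFun.mem_preimage _ _ _).mp ((key U).mp hU)
    refine ⟨y, hy, mem_pointPFun.mpr fun V => (key V).trans ?_⟩
    rw [PFun.mem_preimage]
    exact ⟨fun ⟨y', hV, hy'⟩ => Part.mem_unique hy hy' ▸ hV, fun hV => ⟨y, hV, hy⟩⟩
  · rintro ⟨y, hy, hμ⟩
    have hμ := mem_pointPFun.mp hμ
    have key : ∀ U : koObj D, U ∈ μ ↔ x ∈ ((koMap φ).toFun U).1 := by
      intro U
      refine (hμ U).trans (Iff.trans ?_ (PFun.mem_preimage _ _ _).symm)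
      exact ⟨fun hU => ⟨y, hU, hy⟩, fun ⟨y', hU, hy'⟩ => Part.mem_unique hy hy' ▸ hU⟩
    obtain ⟨U, hU⟩ := μ.exists_mem
    obtain ⟨ν, hν, -⟩ := exists_mem_pointPFun ((key U).mp hU)
    exact ⟨ν, hν, (mem_comapPFun _).mpr fun V =>
      (key V).trans (mem_pointPFun.mp hν _).symm⟩

theorem pointHom_comp_specMap_hatHom (A : DRA.{u}) :
    (pointHom (specObj A) : specObj A ⟶ _) ≫ (specMap (hatHom A) : _ ⟶ specObj A) =
      𝟙 (specObj A) := by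
  refine HausEt.Hom.ext (PFun.ext fun (ξ : MaxFilter A) (μ : MaxFilter A) => ?_)
  refine Part.mem_bind_iff.trans (Iff.trans ?_ Part.mem_some_iff.symm)
  constructor
  · rintro ⟨ν, hν, hμ⟩
    exact MaxFilter.ext fun a => ((mem_comapPFun _).mp hμ a).trans (mem_pointPFun.mp hν _)
  · rintro rfl
    obtain ⟨a, ha⟩ := μ.exists_mem
    obtain ⟨ν, hν, -⟩ := exists_mem_pointPFun (E := specObj A) (U := (hatHom A).toFun a) ha
    exact ⟨ν, hν, (mem_comapPFun _).mpr fun b => (mem_pointPFun.mp hν ((hatHom A).toFun b)).symm⟩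

/-- The adjunction between difference-restriction algebras and Hausdorff étale spaces. -/
def adjunction : F.{u} ⊣ G.{u} := Adjunction.mkOfUnitCounit
  { unit :=
      { app := fun A => hatHom A
        naturality := fun A B h => DRA.Hom.ext (funext fun a =>
          Subtype.ext (preimage_comapPFun_hat h a).symm) }
    counit :=
      { app := fun E => Quiver.Hom.op (X := E.unop) (Y := specObj (koObj E.unop))
          (pointHom E.unop)
        naturality := fun E D φ => Quiver.Hom.unop_inj (pointHom_naturality φ.unop) }
    left_triangle := by
      ext A
      simp only [Functor.whiskerRight_app, NatTrans.comp_app, Functor.whiskerLeft_app,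
        Functor.associator_hom_app]
      exact (congrArg (fun k => F.map (hatHom A) ≫ k) (Category.id_comp _)).trans
        (Quiver.Hom.unop_inj (pointHom_comp_specMap_hatHom A))
    right_triangle := by
      ext E
      simp only [Functor.whiskerRight_app, NatTrans.comp_app, Functor.whiskerLeft_app,
        Functor.associator_inv_app, Category.id_comp]
      exact DRA.Hom.ext (funext fun U => Subtype.ext (preimage_pointPFun_hat U)) }

/-! ### The lifted adjunction -/

section lift
variable {σ : Type v} {ar : σ → ℕ}

/-- The unit `a ↦ hat a` preserves the operators. -/
def hatHomOp (A : DRAOp.{u} ar) : A ⟶ liftGObj (gLifts ar) (liftFObj (fLifts ar) A) where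
  toHom := hatHom A.toDRA
  map_op s a := Subtype.ext (relOp_opRel_hat (A.isCompatibleOperator s) a).symm

/-- The counit satisfies the reverse forth and back conditions. -/
def pointHomRel (E : HausEtRel.{u} ar) : E ⟶ liftFObj (fLifts ar) (liftGObj (gLifts ar) E) where
  toHom := pointHom E.toHausEt
  reverseForth s := reverseForth_pointPFun (E.isAdmissible s)
  back s := back_pointPFun (E.isAdmissible s)

variable (ar) in
/-- The lift of the adjunction to algebras with operators and spaces with relations. -/
def liftAdjunction : liftF.{u} (fLifts ar) ⊣ liftG.{u} (gLifts ar) :=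
  Adjunction.mkOfUnitCounit
  { unit :=
      { app := hatHomOp
        naturality := fun _ _ h => DRAOp.Hom.ext (adjunction.unit.naturality h.toHom) }
    counit :=
      { app := fun E => (pointHomRel E.unop).op
        naturality := fun _ _ φ =>
          Quiver.Hom.unop_inj (HausEtRel.Hom.ext (pointHom_naturality φ.unop.toHom)) }
    left_triangle := by
      ext A
      simp only [Functor.whiskerRight_app, NatTrans.comp_app, Functor.whiskerLeft_app,
        Functor.associator_hom_app]
      exact (congrArg (fun k => (liftF (fLifts ar)).map (hatHomOp A) ≫ k) (Category.id_comp _)).trans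
        (Quiver.Hom.unop_inj (HausEtRel.Hom.ext (pointHom_comp_specMap_hatHom A.toDRA)))
    right_triangle := by
      ext E
      simp only [Functor.whiskerRight_app, NatTrans.comp_app, Functor.whiskerLeft_app,
        Functor.associator_inv_app, Category.id_comp]
      exact DRAOp.Hom.ext (adjunction.right_triangle_components (op E.unop.toHausEt)) }

end lift

end DiffRest

theorem theorem5 {σ : Type v} (ar : σ → ℕ) :
    ∃ (hF : DiffRest.FLifts.{u} ar) (hG : DiffRest.GLifts.{u} ar)
      (adj : DiffRest.F.{u} ⊣ DiffRest.G.{u})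
      (adj' : DiffRest.liftF hF ⊣ DiffRest.liftG hG),
      -- the reducts of the lifted functors are the original functors
      DiffRest.liftF hF ⋙ (DiffRest.HausEtRel.reduct ar).op =
        DiffRest.DRAOp.reduct ar ⋙ DiffRest.F ∧
      DiffRest.liftG hG ⋙ DiffRest.DRAOp.reduct ar =
        (DiffRest.HausEtRel.reduct ar).op ⋙ DiffRest.G ∧
      -- the unit of `F ⊣ G` sends `a` to the set of maximal filters containing `a`
      (∀ (A : DiffRest.DRA.{u}) (a : A),
        ((adj.unit.app A).toFun a).1 = DiffRest.hat a) ∧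
      -- the counit of `F ⊣ G` sends `x` to the set of `U` with `x ∈ U`, if that set is nonempty
      (∀ (E : DiffRest.HausEt.{u}) (x : E.X) (μ : DiffRest.MaxFilter (DiffRest.koObj E)),
        μ ∈ (adj.counit.app (op E)).unop.toPFun x ↔
          ∀ U : DiffRest.koObj E, U ∈ μ ↔ x ∈ U.1) ∧
      -- the unit and counit of the lifted adjunction are those of `F ⊣ G`
      (∀ A : DiffRest.DRAOp.{u} ar,
        (adj'.unit.app A).toHom = adj.unit.app A.toDRA) ∧
      (∀ E : DiffRest.HausEtRel.{u} ar,
        (adj'.counit.app (op E)).unop.toHom = (adj.counit.app (op E.toHausEt)).unop) := by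
  -- The lifts are built on the same underlying data, so the comparisons of functors, units and
  -- counits hold by definition.
  refine ⟨DiffRest.fLifts ar, DiffRest.gLifts ar, DiffRest.adjunction,
    DiffRest.liftAdjunction ar, rfl, rfl, fun _ _ => rfl, fun _ _ _ => DiffRest.mem_pointPFun,
    fun _ => rfl, fun _ => rfl⟩
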